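/- **Conventions.** $\hat{\mathbb C}$ is the Riemann sphere with spherical distance $\hat\rho$ (geodesic distance of $2|dz|/(1+|z|^2)$), and $\|g'(z)\|$ is the norm of the derivative of a rational map $g$ in the spherical metric. For non-constant rational maps $f=(f_1,\dots,f_m)$ let $\langle f_1,\dots,f_m\rangle$ be the semigroup they generate under composition. The Fatou set $F(G)$ of a semigroup $G$ of rational maps is the set of points having a neighbourhood on which $G$ is normal, and $J(G)=\hat{\mathbb C}\setminus F(G)$. Let $\Sigma_m=\{1,\dots,m\}^{\mathbb N}$ with shift $\sigma$, and $\tilde f(\omega,z)=(\sigma\omega,f_{\omega_1}(z))$ on $\Sigma_m\times\hat{\mathbb C}$. Let $J_\omega(\tilde f)$ be the set of points having no neighbourhood on which $\{f_{\omega_n}\circ\cdots\circ f_{\omega_1}\}_{n\ge1}$ is normal, and $J(\tilde f)=\overline{\bigcup_\omega\{\omega\}\times J_\omega(\tilde f)}$. $\mathrm{Exp}(m)$ is the set of $m$-tuples $f$ of non-constant rational maps such that $J(\langle f_1,\dots,f_m\rangle)\ne\emptyset$ and there are $\eta>1$, $C\in(0,1]$ with $\|(f_{\omega_n}\circ\cdots\circ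 f_{\omega_1})'(z)\|\ge C\eta^n$ for all $n\ge1$ and $(\omega,z)\in J(\tilde f)$. A family $\{f_\lambda\}_{\lambda\in U}$ in $\mathrm{Exp}(m)$ over an open $U\subset\mathbb C^N$ is a *holomorphic family* if $(z,\lambda)\mapsto f_{\lambda,j}(z)$ is holomorphic on $\hat{\mathbb C}\times U$ for each $j$. $\mathrm{Aut}(\mathbb C)=\{az+b: a\ne0\}$ is identified with $(\mathbb C\setminus\{0\})\times\mathbb C$ by the coefficients, so $\mathrm{Aut}(\mathbb C)^m$ is an open subset of $\mathbb C^{2m}\cong\mathbb R^{4m}$ with the Euclidean norm; its elements are denoted $\gamma=(\gamma_1,\dots,\gamma_m)$, and $G_\gamma=\langle\gamma_1,\dots,\gamma_m\rangle$. **Theorem.** Let $m\ge2$, and for $i=1,\dots,m$ let $g_i(z)=a_iz+b_i$ with $a_i,b_i\in\mathbb C$, $|a_i|>1$. Put $G=\langle g_1,\dots,g_m\rangle$ and suppose: (i) for each $i\ne j$ with $g_i^{-1}(J(G))\cap g_j^{-1}(J(G))\ne\emptyset$ there is $\alpha_{ij}\in\{1,\dots,m\}$ with $g_i\bigl(g_i^{-1}(J(G))\cap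 g_j^{-1}(J(G))\bigr)\subset\bigl\{\tfrac{-b_{\alpha_{ij}}}{a_{\alpha_{ij}}-1}\bigr\}$; (ii) for all mutually distinct $i,j,k$, $g_k\bigl(g_i^{-1}(J(G))\cap g_j^{-1}(J(G))\bigr)\subset F(G)$; (iii) for all $j\ne k$, $g_k\bigl(\tfrac{-b_j}{a_j-1}\bigr)\in F(G)$. Then there is a bounded open neighbourhood $U$ of $\gamma_0:=(g_1,\dots,g_m)$ in $\mathrm{Aut}(\mathbb C)^m$ such that $\{\gamma\}_{\gamma\in U}$ is a holomorphic family in $\mathrm{Exp}(m)$, $U\ni\gamma\mapsto\gamma$ is continuous for the distance $\sup_z\hat\rho$, and there are homeomorphisms $h_\gamma:J(\tilde\gamma_0)\to J(\tilde\gamma)$ $(\gamma\in U)$ of the form $h_\gamma(\omega,z)=(\omega,\overline h_\gamma(\omega,z))$, with $h_{\gamma_0}=\mathrm{Id}$, $h_\gamma\circ\tilde\gamma_0=\tilde\gamma\circ h_\gamma$ on $J(\tilde\gamma_0)$, and $(\omega,z,\gamma)\mapsto\overline h_\gamma(\omega,z)$ continuous on $J(\tilde\gamma_0)\times U$, for which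 the following three conditions hold. * **Analytic transversality condition:** $\gamma\mapsto\overline h_\gamma(\omega,z)$ is holomorphic on $U$ for each $(\omega,z)\in J(\tilde\gamma_0)$; $J(G_\gamma)\subset\mathbb C$ for each $\gamma\in U$; and for all $(\omega,z),(\omega',z')\in J(\tilde\gamma_0)$ with $\omega_1\ne\omega_1'$ and all $\gamma\in U$ with $\overline h_\gamma(\omega,z)=\overline h_\gamma(\omega',z')$, the complex gradient $\nabla_\gamma\bigl(\overline h_\gamma(\omega,z)-\overline h_\gamma(\omega',z')\bigr)$ is non-zero at $\gamma$. * **Strong transversality condition:** with $d=4m$, there is $C_1'>0$ such that for all $r\in(0,\mathrm{diam}\,\hat{\mathbb C})$ and all $(\omega,z),(\omega',z')\in J(\tilde\gamma_0)$ with $\omega_1\ne\omega_1'$, the set $\{\gamma\in U:\hat\rho(\overline h_\gamma(\omega,z),\overline h_\gamma(\omega',z'))\le r\}$ can be covered by at most $C_1'r^{2-d}$ balls of radius $r$. * **Transversality condition:** there is $C_1>0$ such that for the same $r$ and pairs of points, this set has $4m$-dimensional Lebesgue measure at most $C_1r^2$. -/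

import Mathlib

open Set Filter Topology MeasureTheory
open scoped ENNReal OnePoint

noncomputable section

namespace RatSemi

/-! ### The Riemann sphere -/

/-- The Riemann sphere, the one-point compactification of `ℂ`. -/
abbrev RSphere : Type := OnePoint ℂ

/-- The chordal distance on the Riemann sphere, seen as the unit sphere of `ℝ³`. -/
def chordalDist : RSphere → RSphere → ℝ
  | none, none => 0
  | none, some w => 2 / √(1 + ‖w‖ ^ 2)
  | some z, none => 2 / √(1 + ‖z‖ ^ 2)
  | some z, some w => 2 * ‖z - w‖ / (√(1 + ‖z‖ ^ 2) * √(1 + ‖w‖ ^ 2))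

/-- The spherical distance: the geodesic distance of the metric `2|dz| / (1 + |z|²)`
(a chord of length `c` of the unit sphere subtends an arc of length `2 arcsin (c / 2)`). -/
def sphDist (x y : RSphere) : ℝ := 2 * Real.arcsin (chordalDist x y / 2)

/-- The diameter of the Riemann sphere with respect to `sphDist`. -/
def sphDiam : ℝ := Real.pi

theorem sphDist_le_sphDiam (x y : RSphere) : sphDist x y ≤ sphDiam := by
  have := Real.arcsin_le_pi_div_two (chordalDist x y / 2)
  unfold sphDist sphDiam
  linarith

theorem sphDist_zero_infty : sphDist ((0 : ℂ) : RSphere) ∞ = sphDiam := by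
  have h : chordalDist ((0 : ℂ) : RSphere) ∞ = 2 := by
    change 2 / √(1 + ‖(0 : ℂ)‖ ^ 2) = 2
    simp
  unfold sphDist sphDiam
  rw [h, div_self two_ne_zero, Real.arcsin_one]
  ring

/-- The value of a finite point of the sphere (with the junk value `0` at `∞`). -/
def fin : RSphere → ℂ
  | none => 0
  | some z => z

/-- The involution `z ↦ 1 / z` of the sphere, exchanging `0` and `∞`. -/
def sphInv : RSphere → RSphere
  | none => ((0 : ℂ) : RSphere)
  | some z => if z = 0 then ∞ else ((z⁻¹ : ℂ) : RSphere)

/-- The holomorphic coordinate used near the point `p`: it is `x ↦ x` if `p ≠ ∞`, and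
`x ↦ 1 / x` if `p = ∞`. -/
def toChart (p x : RSphere) : ℂ :=
  match p with
  | none => fin (sphInv x)
  | some _ => fin x

/-- The inverse of the coordinate `toChart p`. -/
def ofChart (p : RSphere) (w : ℂ) : RSphere :=
  match p with
  | none => sphInv (w : RSphere)
  | some _ => (w : RSphere)

/-- The norm `‖g'(p)‖` of the derivative of a holomorphic map `g` of the sphere with respect to
the spherical metric, which is `2|dw| / (1 + |w|²)` in each of the two coordinates. -/
def sphDerivNorm (g : RSphere → RSphere) (p : RSphere) : ℝ :=
  ‖deriv (fun w : ℂ => toChart (g p) (g (ofChart p w))) (toChart p p)‖ *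
    ((1 + ‖toChart p p‖ ^ 2) / (1 + ‖toChart (g p) (g p)‖ ^ 2))

/-- Holomorphy on the (open) set `U` of a sphere-valued map, in the coordinates of the sphere. -/
def SphHolomorphicOn {E : Type*} [NormedAddCommGroup E] [NormedSpace ℂ E]
    (F : E → RSphere) (U : Set E) : Prop :=
  ∀ l ∈ U, ContinuousAt F l ∧ DifferentiableAt ℂ (fun u => toChart (F l) (F u)) l

/-! ### Rational maps -/

/-- The self-map of the sphere given by `z ↦ p(z) / q(z)`, for coprime polynomials `p`, `q`. -/
def ratMap (p q : Polynomial ℂ) : RSphere → RSphere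
  | none => if q.natDegree < p.natDegree then ∞ else
      ((p.coeff q.natDegree / q.coeff q.natDegree : ℂ) : RSphere)
  | some z => if q.eval z = 0 then ∞ else ((p.eval z / q.eval z : ℂ) : RSphere)

/-- The set of non-constant rational maps of the sphere. -/
def RatMaps : Set (RSphere → RSphere) :=
  {g | ∃ p q : Polynomial ℂ, IsCoprime p q ∧ 1 ≤ max p.natDegree q.natDegree ∧ g = ratMap p q}

/-! ### Fatou and Julia sets -/

/-- The family `F` is normal on the open set `V`: each sequence in `F` has a subsequence which
converges uniformly on the compact subsets of `V`, for the spherical distance. -/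
def NormalOn (F : Set (RSphere → RSphere)) (V : Set RSphere) : Prop :=
  ∀ u : ℕ → RSphere → RSphere, (∀ n, u n ∈ F) →
    ∃ φ : ℕ → ℕ, StrictMono φ ∧ ∃ g : RSphere → RSphere,
      ∀ K ⊆ V, IsCompact K → ∀ ε > 0, ∀ᶠ n in atTop, ∀ z ∈ K, sphDist (u (φ n) z) (g z) < ε

/-- The set of points having a neighbourhood in which the family `F` is normal. -/
def normalitySet (F : Set (RSphere → RSphere)) : Set RSphere :=
  {z | ∃ V : Set RSphere, IsOpen V ∧ z ∈ V ∧ NormalOn F V}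

variable {m : ℕ}

/-- The semigroup `⟨f₁, …, f_m⟩` generated by the `f_j` under composition. -/
def semigroup (f : Fin m → RSphere → RSphere) : Set (RSphere → RSphere) :=
  (Subsemigroup.closure (Set.range f : Set (Function.End RSphere)) :
    Set (Function.End RSphere))

/-- The Fatou set of the semigroup `⟨f₁, …, f_m⟩`. -/
def fatouSet (f : Fin m → RSphere → RSphere) : Set RSphere := normalitySet (semigroup f)

/-- The Julia set of the semigroup `⟨f₁, …, f_m⟩`. -/
def juliaSet (f : Fin m → RSphere → RSphere) : Set RSphere := (fatouSet f)ᶜ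

/-! ### The skew product -/

/-- The space `Σ_m` of one-sided sequences; the first letter of `ω` is `ω 0`. -/
abbrev Words (m : ℕ) : Type := ℕ → Fin m

/-- The skew product map `(ω, z) ↦ (σ ω, f_{ω₁} z)`. -/
def skew (f : Fin m → RSphere → RSphere) (x : Words m × RSphere) : Words m × RSphere :=
  (fun n => x.1 (n + 1), f (x.1 0) x.2)

/-- The composition `f_{ω_n} ∘ ⋯ ∘ f_{ω_1}`. -/
def fiberIter (f : Fin m → RSphere → RSphere) (ω : Words m) : ℕ → RSphere → RSphere
  | 0 => id
  | n + 1 => f (ω n) ∘ fiberIter f ω n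

/-- The Julia set `J_ω` of the sequence `(f_{ω_n} ∘ ⋯ ∘ f_{ω_1})_{n ≥ 1}`. -/
def fiberJulia (f : Fin m → RSphere → RSphere) (ω : Words m) : Set RSphere :=
  (normalitySet {g | ∃ n ≥ 1, g = fiberIter f ω n})ᶜ

/-- The Julia set of the skew product map: the closure of `⋃_ω {ω} × J_ω`. -/
def skewJulia (f : Fin m → RSphere → RSphere) : Set (Words m × RSphere) :=
  closure {x | x.2 ∈ fiberJulia f x.1}

/-- `⟨f₁, …, f_m⟩` is expanding: its Julia set is non-empty, and the skew product is uniformly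
expanding along the fibres of its Julia set. -/
def IsExpanding (f : Fin m → RSphere → RSphere) : Prop :=
  (juliaSet f).Nonempty ∧ ∃ η > (1 : ℝ), ∃ C ∈ Set.Ioc (0 : ℝ) 1, ∀ n ≥ 1,
    ∀ x ∈ skewJulia f, C * η ^ n ≤ sphDerivNorm (fiberIter f x.1 n) x.2

/-- The space `Exp(m)` of expanding `m`-tuples of non-constant rational maps. -/
def ExpSet (m : ℕ) : Set (Fin m → RSphere → RSphere) :=
  {f | (∀ j, f j ∈ RatMaps) ∧ IsExpanding f}

/-! ### Families of multimaps -/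

/-- `{f_l}_{l ∈ U}` is a holomorphic family in `Exp(m)` over the open set `U`: each `f_l` is in
`Exp(m)`, and each `(l, z) ↦ f_{l,j}(z)` is holomorphic on `U × RSphere`, in the coordinates of
the sphere. -/
def IsHolomorphicFamily {E : Type*} [NormedAddCommGroup E] [NormedSpace ℂ E]
    (f : E → Fin m → RSphere → RSphere) (U : Set E) : Prop :=
  (∀ l ∈ U, f l ∈ ExpSet m) ∧
  ∀ j, ∀ l ∈ U, ∀ z : RSphere,
    ContinuousAt (fun y : E × RSphere => f y.1 j y.2) (l, z) ∧
    DifferentiableAt ℂ (fun y : E × ℂ => toChart (f l j z) (f y.1 j (ofChart z y.2)))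
      (l, toChart z z)

/-- `{h_l}_{l ∈ U}`, with `h_l(ω, z) = (ω, hbar l (ω, z))`, is a family of homeomorphisms from
the skew Julia set at the base point `l₀` to the one at `l`, which conjugate the skew products,
which depends continuously on all the variables, and with `h_{l₀}` the identity. -/
structure IsConjugacyFamily {E : Type*} [TopologicalSpace E]
    (f : E → Fin m → RSphere → RSphere) (U : Set E) (l₀ : E)
    (hbar : E → Words m × RSphere → RSphere) : Prop where
  homeo : ∀ l ∈ U, ∃ e : skewJulia (f l₀) ≃ₜ skewJulia (f l),
    ∀ x : skewJulia (f l₀), (e x : Words m × RSphere) = (x.1.1, hbar l x.1)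
  base : ∀ x ∈ skewJulia (f l₀), hbar l₀ x = x.2
  conj : ∀ l ∈ U, ∀ x ∈ skewJulia (f l₀),
    ((skew (f l₀) x).1, hbar l (skew (f l₀) x)) = skew (f l) (x.1, hbar l x)
  cont : ContinuousOn (fun y : (Words m × RSphere) × E => hbar y.2 y.1)
    (skewJulia (f l₀) ×ˢ U)

/-- The standing setting for a family over a subset `U` of a Euclidean space `E`, with base point
`l₀` and conjugacies given by `hbar`. The field `cont` is continuity of `l ↦ f_l` for the
distance `sup_z sphDist (h₁ z) (h₂ z)` on rational maps. -/
structure Setting {E : Type*} [NormedAddCommGroup E]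
    (f : E → Fin m → RSphere → RSphere) (U : Set E) (l₀ : E)
    (hbar : E → Words m × RSphere → RSphere) : Prop where
  isOpen : IsOpen U
  isBounded : Bornology.IsBounded U
  mem : l₀ ∈ U
  exp : ∀ l ∈ U, f l ∈ ExpSet m
  cont : ∀ l ∈ U, ∀ ε > 0, ∀ᶠ u in 𝓝[U] l, ∀ j z, sphDist (f u j z) (f l j z) < ε
  conjugacy : IsConjugacyFamily f U l₀ hbar

/-- The set of the parameters `l ∈ U` for which the points `hbar l x` and `hbar l x'` are at
spherical distance at most `r`. -/
def closeParams {E : Type*} (U : Set E) (hbar : E → Words m × RSphere → RSphere)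
    (x x' : Words m × RSphere) (r : ℝ) : Set E :=
  {l ∈ U | sphDist (hbar l x) (hbar l x') ≤ r}

/-- The transversality condition, for a family over a subset `U` of a Euclidean space. -/
def TC {E : Type*} [NormedAddCommGroup E] [InnerProductSpace ℝ E] [FiniteDimensional ℝ E]
    [MeasurableSpace E] [BorelSpace E]
    (f : E → Fin m → RSphere → RSphere) (U : Set E) (l₀ : E)
    (hbar : E → Words m × RSphere → RSphere) : Prop :=
  Setting f U l₀ hbar ∧
  ∃ C > (0 : ℝ), ∀ r ∈ Set.Ioo 0 sphDiam, ∀ x ∈ skewJulia (f l₀), ∀ x' ∈ skewJulia (f l₀),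
    x.1 0 ≠ x'.1 0 → volume (closeParams U hbar x x' r) ≤ ENNReal.ofReal (C * r ^ 2)

/-- The minimal number of balls of radius `r` needed to cover `F` (`⊤` if no finite number of
balls is enough). -/
def ballCoveringNumber {E : Type*} [PseudoMetricSpace E] (r : ℝ) (F : Set E) : ℕ∞ :=
  ⨅ (c : Finset E) (_ : F ⊆ ⋃ y ∈ c, Metric.ball y r), (c.card : ℕ∞)

/-- The strong transversality condition, for a family over a subset `U` of a Euclidean space of
real dimension `d = Module.finrank ℝ E`. -/
def STC {E : Type*} [NormedAddCommGroup E] [InnerProductSpace ℝ E] [FiniteDimensional ℝ E]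
    (f : E → Fin m → RSphere → RSphere) (U : Set E) (l₀ : E)
    (hbar : E → Words m × RSphere → RSphere) : Prop :=
  Setting f U l₀ hbar ∧
  ∃ C > (0 : ℝ), ∀ r ∈ Set.Ioo 0 sphDiam, ∀ x ∈ skewJulia (f l₀), ∀ x' ∈ skewJulia (f l₀),
    x.1 0 ≠ x'.1 0 → (ballCoveringNumber r (closeParams U hbar x x' r) : ℝ≥0∞) ≤
      ENNReal.ofReal (C * r ^ (2 - (Module.finrank ℝ E : ℤ)))

/-- The complex gradient `(∂g/∂l_k)_k` of a function on `ℂ^κ`. -/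
def complexGradient {κ : Type*} [Fintype κ] [DecidableEq κ] (g : EuclideanSpace ℂ κ → ℂ)
    (l : EuclideanSpace ℂ κ) : κ → ℂ :=
  fun k => lineDeriv ℂ g l (EuclideanSpace.single k 1)

/-- The analytic transversality condition, for a family over an open subset `U` of `ℂ^κ`. -/
def ATC {κ : Type*} [Fintype κ] [DecidableEq κ]
    (f : EuclideanSpace ℂ κ → Fin m → RSphere → RSphere) (U : Set (EuclideanSpace ℂ κ))
    (l₀ : EuclideanSpace ℂ κ) (hbar : EuclideanSpace ℂ κ → Words m × RSphere → RSphere) :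
    Prop :=
  IsOpen U ∧ l₀ ∈ U ∧ IsHolomorphicFamily f U ∧ IsConjugacyFamily f U l₀ hbar ∧
  (∀ x ∈ skewJulia (f l₀), SphHolomorphicOn (fun l => hbar l x) U) ∧
  (∀ l ∈ U, (∞ : RSphere) ∉ juliaSet (f l)) ∧
  ∀ x ∈ skewJulia (f l₀), ∀ x' ∈ skewJulia (f l₀), x.1 0 ≠ x'.1 0 →
    ∀ l ∈ U, fin (hbar l x) - fin (hbar l x') = 0 →
      complexGradient (fun u => fin (hbar u x) - fin (hbar u x')) l ≠ 0

/-! ### Affine maps -/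

/-- The affine map `z ↦ a z + b`, extended to the sphere by `∞ ↦ ∞`. -/
def affine (a b : ℂ) : RSphere → RSphere := OnePoint.map (fun z => a * z + b)

/-- The coordinate space `ℂ^{2m}` of `m`-tuples of affine maps; the coordinates `(i, 0)` and
`(i, 1)` are the two coefficients of the `i`-th map. -/
abbrev AffineParam (m : ℕ) : Type := EuclideanSpace ℂ (Fin m × Fin 2)

/-- The tuple of affine maps with given coefficients. -/
def affineTuple (l : AffineParam m) : Fin m → RSphere → RSphere :=
  fun i => affine (l (i, 0)) (l (i, 1))

/-- The coefficients of the elements of `Aut(ℂ)^m`, as an open subset of `ℂ^{2m}`. -/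
def autParams (m : ℕ) : Set (AffineParam m) := {l | ∀ i, l (i, 0) ≠ 0}

/-- The coordinates of the tuple of the maps `a_i z + b_i`. -/
def affineCoord (a b : Fin m → ℂ) : AffineParam m :=
  WithLp.toLp 2 (fun k => if k.2 = 0 then a k.1 else b k.1)

theorem affineTuple_affineCoord (a b : Fin m → ℂ) :
    affineTuple (affineCoord a b) = fun i => affine (a i) (b i) := by
  funext i
  simp [affineTuple, affineCoord]

end RatSemi

end

open RatSemi

/-!
The inverse branches of expanding affine maps `a_i z + b_i` contract `ℂ`, so each sequence `ω` has
exactly one point `u ω` with a bounded orbit under the compositions along `ω`. The function `u`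
(the *coding*) satisfies `u (σ ω) = a_{ω₁} u ω + b_{ω₁}`. All the other orbits go to `∞`, locally uniformly,
which identifies the Julia sets: `J_ω = {u ω}`, the Julia set of the skew product is the graph of
`u`, and that of the semigroup is the range of `u` (`normalitySet_eq`). The conjugacies only have
to preserve the codes (`codingMap`).

The equation for `u` is an affine fixed point equation in the Banach space `C(Words m, ℂ)`, with a
linear part of norm less than `1` which is holomorphic in the coefficients. Hence the coding is a
continuously differentiable function of the coefficients, as an element of `C(Words m, ℂ)`
(`contDiffAt_coding`); this gives the holomorphic motion and uniform estimates in `ω` at once.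

Transversality at the given coefficients is algebra. If `u ω = u ω'` and the first letters `i`, `j`
differ, the hypotheses on the Julia set force `ω = i p p p …` and `ω' = j q q q …` with `p ≠ i`
and `q ≠ j`, and differentiating the fixed point equation shows that the gradient of
`u ω - u ω'` is not zero (`exists_derivative_ne`). By compactness of the set of pairs of
sequences, and strict differentiability of the coding, this transversality is uniform on a ball
(`exists_uniform_transversality`): for each pair, either `|u ω - u ω'|` is bounded below, or
`u ω - u ω'` is one of the coordinates of an expanding system of coordinates. In such coordinates,
the set `|u ω - u ω'| ≤ C r` lies in a bounded part of a slab of complex codimension `1` and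
width `O(r)`, so that counting cubes of size `r` bounds the number of balls of radius `r` which
cover it (`exists_cover_of_expanding`). The bound for its Lebesgue measure follows.
-/

namespace RatSemi

/-! ### The spherical distance and the topology of the sphere -/

theorem chordalDist_coe_coe (z w : ℂ) : chordalDist (z : RSphere) (w : RSphere) =
    2 * ‖z - w‖ / (√(1 + ‖z‖ ^ 2) * √(1 + ‖w‖ ^ 2)) := rfl

theorem chordalDist_coe_infty (z : ℂ) : chordalDist (z : RSphere) ∞ = 2 / √(1 + ‖z‖ ^ 2) := rfl

theorem one_le_sqrt_one_add_sq (x : ℝ) : 1 ≤ √(1 + x ^ 2) :=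
  Real.one_le_sqrt.2 (by nlinarith)

theorem sqrt_one_add_sq_le {x : ℝ} (hx : 0 ≤ x) : √(1 + x ^ 2) ≤ 1 + x :=
  Real.sqrt_le_iff.2 ⟨by linarith, by nlinarith⟩

theorem le_sqrt_one_add_sq (x : ℝ) : x ≤ √(1 + x ^ 2) :=
  Real.le_sqrt_of_sq_le (by linarith)

theorem chordalDist_coe_coe_le_two (z w : ℂ) : chordalDist (z : RSphere) (w : RSphere) ≤ 2 := by
  rw [chordalDist_coe_coe, ← Real.sqrt_mul (by positivity), div_le_iff₀ (by positivity)]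
  gcongr
  refine Real.le_sqrt_of_sq_le ?_
  have h := norm_sub_le z w
  have h0 := norm_nonneg (z - w)
  nlinarith [sq_nonneg (1 - ‖z‖ * ‖w‖)]

theorem chordalDist_coe_infty_le_two (z : ℂ) : chordalDist (z : RSphere) ∞ ≤ 2 := by
  rw [chordalDist_coe_infty]
  exact div_le_self zero_le_two (one_le_sqrt_one_add_sq _)

theorem chordalDist_coe_le_two (z : ℂ) (y : RSphere) : chordalDist (z : RSphere) y ≤ 2 := by
  induction y using OnePoint.rec with
  | infty => exact chordalDist_coe_infty_le_two z
  | coe w => exact chordalDist_coe_coe_le_two z w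

theorem chordalDist_coe_nonneg (z : ℂ) (y : RSphere) : 0 ≤ chordalDist (z : RSphere) y := by
  induction y using OnePoint.rec with
  | infty => rw [chordalDist_coe_infty]; positivity
  | coe w => rw [chordalDist_coe_coe]; positivity

theorem arcsin_le_pi_div_two_mul {x : ℝ} (h0 : 0 ≤ x) (h1 : x ≤ 1) :
    Real.arcsin x ≤ Real.pi / 2 * x := by
  have h := Real.mul_le_sin (Real.arcsin_nonneg.2 h0) (Real.arcsin_le_pi_div_two x)
  rw [Real.sin_arcsin (by linarith) h1] at h
  calc Real.arcsin x = Real.pi / 2 * (2 / Real.pi * Real.arcsin x) := by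
        field_simp
    _ ≤ _ := by gcongr

theorem le_arcsin {x : ℝ} (h0 : 0 ≤ x) (h1 : x ≤ 1) : x ≤ Real.arcsin x := by
  have h := Real.sin_le (Real.arcsin_nonneg.2 h0)
  rwa [Real.sin_arcsin (by linarith) h1] at h

theorem sphDist_le_mul_chordalDist (z : ℂ) (y : RSphere) :
    sphDist (z : RSphere) y ≤ Real.pi / 2 * chordalDist (z : RSphere) y := by
  have h := arcsin_le_pi_div_two_mul (x := chordalDist (z : RSphere) y / 2)
    (by linarith [chordalDist_coe_nonneg z y]) (by linarith [chordalDist_coe_le_two z y])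
  unfold sphDist
  linarith

theorem chordalDist_le_sphDist (z : ℂ) (y : RSphere) :
    chordalDist (z : RSphere) y ≤ sphDist (z : RSphere) y := by
  have h := le_arcsin (x := chordalDist (z : RSphere) y / 2)
    (by linarith [chordalDist_coe_nonneg z y]) (by linarith [chordalDist_coe_le_two z y])
  unfold sphDist
  linarith

theorem sphDist_self (x : RSphere) : sphDist x x = 0 := by
  have h : chordalDist x x = 0 := by
    induction x using OnePoint.rec with
    | infty => rfl
    | coe w => simp [chordalDist_coe_coe]
  simp [sphDist, h]

theorem sphDist_coe_infty_le {z : ℂ} (hz : z ≠ 0) : sphDist (z : RSphere) ∞ ≤ Real.pi / ‖z‖ := by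
  refine (sphDist_le_mul_chordalDist z ∞).trans ?_
  rw [chordalDist_coe_infty]
  have hz' : 0 < ‖z‖ := norm_pos_iff.2 hz
  calc Real.pi / 2 * (2 / √(1 + ‖z‖ ^ 2)) ≤ Real.pi / 2 * (2 / ‖z‖) := by
        have := Real.pi_pos
        gcongr
        exact le_sqrt_one_add_sq _
    _ = _ := by ring

theorem le_sphDist_coe_infty (z : ℂ) : 2 / (1 + ‖z‖) ≤ sphDist (z : RSphere) ∞ := by
  refine le_trans ?_ (chordalDist_le_sphDist z ∞)
  rw [chordalDist_coe_infty]
  gcongr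
  exact sqrt_one_add_sq_le (norm_nonneg _)

/-- On bounded sets, the Euclidean distance is controlled by the spherical distance. -/
theorem norm_sub_le_mul_sphDist {R : ℝ} {z w : ℂ} (hz : ‖z‖ ≤ R) (hw : ‖w‖ ≤ R) :
    ‖z - w‖ ≤ (1 + R) ^ 2 * sphDist (z : RSphere) (w : RSphere) := by
  have h := chordalDist_le_sphDist z w
  have h0 := chordalDist_coe_nonneg z w
  have hR : 0 ≤ R := (norm_nonneg z).trans hz
  have h1 : √(1 + ‖z‖ ^ 2) * √(1 + ‖w‖ ^ 2) ≤ (1 + R) * (1 + R) := by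
    gcongr
    · exact (sqrt_one_add_sq_le (norm_nonneg _)).trans (by linarith)
    · exact (sqrt_one_add_sq_le (norm_nonneg _)).trans (by linarith)
  have h2 : 2 * ‖z - w‖ = chordalDist (z : RSphere) (w : RSphere) *
      (√(1 + ‖z‖ ^ 2) * √(1 + ‖w‖ ^ 2)) := by
    rw [chordalDist_coe_coe]
    field_simp
  have h3 : 2 * ‖z - w‖ ≤ sphDist (z : RSphere) (w : RSphere) * ((1 + R) * (1 + R)) := by
    rw [h2]
    exact mul_le_mul h h1 (by positivity) (h0.trans h)
  nlinarith [norm_nonneg (z - w)]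

/-- A finite point of the sphere is at positive spherical distance from a neighbourhood of `∞`. -/
theorem one_div_sqrt_le_sphDist {z w : ℂ} (h : 1 + 2 * ‖w‖ ≤ ‖z‖) :
    1 / √(1 + ‖w‖ ^ 2) ≤ sphDist (z : RSphere) (w : RSphere) := by
  refine le_trans ?_ (chordalDist_le_sphDist z w)
  rw [chordalDist_coe_coe, ← div_div]
  gcongr
  rw [le_div_iff₀ (by positivity), one_mul]
  have h1 := norm_sub_norm_le z w
  have h2 := sqrt_one_add_sq_le (norm_nonneg z)
  linarith

theorem tendsto_nhds_infty_iff {α : Type*} {F : α → RSphere} {l : Filter α} :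
    Tendsto F l (𝓝 ∞) ↔ ∀ R : ℝ, ∀ᶠ x in l, F x = (∞ : RSphere) ∨ R < ‖fin (F x)‖ := by
  have key : (𝓝 (∞ : RSphere)).HasBasis (fun _ : ℝ => True)
      (fun R => {x | x = (∞ : RSphere) ∨ R < ‖fin x‖}) := by
    refine OnePoint.hasBasis_nhds_infty.to_hasBasis ?_ ?_
    · rintro s ⟨-, hs⟩
      obtain ⟨R, hR⟩ := hs.isBounded.exists_norm_le
      refine ⟨R, trivial, ?_⟩
      rintro x (rfl | hx)
      · exact Or.inr rfl
      · induction x using OnePoint.rec with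
        | infty => exact Or.inr rfl
        | coe z => exact Or.inl ⟨z, fun hz => absurd (hR z hz) (not_le.2 hx), rfl⟩
    · intro R _
      refine ⟨Metric.closedBall 0 R,
        ⟨Metric.isClosed_closedBall, isCompact_closedBall _ _⟩, ?_⟩
      rintro x (⟨z, hz, rfl⟩ | rfl)
      · exact Or.inr (by simpa [fin] using hz)
      · exact Or.inl rfl
  rw [key.tendsto_right_iff]
  simp only [true_implies, mem_ofPred_eq]

/-! ### Affine maps of the sphere -/

theorem affine_coe (a b z : ℂ) : affine a b (z : RSphere) = ((a * z + b : ℂ) : RSphere) := rfl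

theorem affine_infty (a b : ℂ) : affine a b ∞ = (∞ : RSphere) := rfl

theorem affine_mem_ratMaps {a : ℂ} (ha : a ≠ 0) (b : ℂ) : affine a b ∈ RatMaps := by
  refine ⟨Polynomial.C a * Polynomial.X + Polynomial.C b, 1, isCoprime_one_right, ?_, ?_⟩
  · rw [Polynomial.natDegree_linear ha]
    simp
  · funext x
    induction x using OnePoint.rec with
    | infty =>
      change (∞ : RSphere) = if _ then _ else _
      rw [Polynomial.natDegree_linear ha]
      simp
    | coe z =>
      change _ = if _ then _ else _
      simp [affine_coe]

theorem norm_le_of_affine {a b z : ℂ} (ha : a ≠ 0) : ‖z‖ ≤ (‖a * z + b‖ + ‖b‖) / ‖a‖ := by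
  rw [le_div_iff₀ (norm_pos_iff.2 ha), mul_comm, ← norm_mul]
  calc ‖a * z‖ = ‖(a * z + b) - b‖ := by ring_nf
    _ ≤ _ := norm_sub_le _ _

/-- The evaluation of affine maps is jointly continuous in the coefficients and the point. -/
theorem continuousAt_affine {E : Type*} [TopologicalSpace E] {A B : E → ℂ} {l : E}
    (hA : ContinuousAt A l) (hB : ContinuousAt B l) (h0 : A l ≠ 0) (z : RSphere) :
    ContinuousAt (fun y : E × RSphere => affine (A y.1) (B y.1) y.2) (l, z) := by
  have hA' : Tendsto (fun y : E × RSphere => A y.1) (𝓝 (l, z)) (𝓝 (A l)) :=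
    hA.tendsto.comp continuousAt_fst
  have hB' : Tendsto (fun y : E × RSphere => B y.1) (𝓝 (l, z)) (𝓝 (B l)) :=
    hB.tendsto.comp continuousAt_fst
  induction z using OnePoint.rec with
  | infty =>
    change Tendsto _ _ (𝓝 (∞ : RSphere))
    rw [tendsto_nhds_infty_iff]
    intro R
    have hS : ∀ R' : ℝ, ∀ᶠ y : E × RSphere in 𝓝 (l, (∞ : RSphere)),
        y.2 = (∞ : RSphere) ∨ R' < ‖fin y.2‖ :=
      tendsto_nhds_infty_iff.1 (continuousAt_snd (p := (l, (∞ : RSphere))))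
    have hp : 0 < ‖A l‖ := norm_pos_iff.2 h0
    filter_upwards [hS (2 * (|R| + (‖B l‖ + 1)) / ‖A l‖),
      hA'.norm.eventually_const_lt (half_lt_self hp),
      hB'.norm.eventually_lt_const (lt_add_one _)] with y hy hyA hyB
    obtain ⟨u, x⟩ := y
    induction x using OnePoint.rec with
    | infty => exact Or.inl rfl
    | coe w =>
      right
      change R < ‖A u * w + B u‖
      replace hy : 2 * (|R| + (‖B l‖ + 1)) / ‖A l‖ < ‖w‖ := by
        rcases hy with h | h
        · exact absurd h (OnePoint.coe_ne_infty w)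
        · exact h
      change ‖A l‖ / 2 < ‖A u‖ at hyA
      change ‖B u‖ < _ at hyB
      rw [div_lt_iff₀ hp] at hy
      have h1 : ‖A u * w‖ - ‖B u‖ ≤ ‖A u * w + B u‖ := by
        have := norm_sub_le (A u * w + B u) (B u)
        simp only [add_sub_cancel_right] at this
        linarith
      rw [norm_mul] at h1
      have h2 : ‖A l‖ / 2 * ‖w‖ ≤ ‖A u‖ * ‖w‖ := by gcongr
      linarith [le_abs_self R]
  | coe w =>
    have e : (𝓝 ((l, (w : RSphere)) : E × RSphere)) =
        map (fun y : E × ℂ => (y.1, (y.2 : RSphere))) (𝓝 (l, w)) := by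
      rw [nhds_prod_eq, nhds_prod_eq, OnePoint.nhds_coe_eq]
      exact (prod_map_right _ _ _)
    rw [ContinuousAt, e, tendsto_map'_iff]
    change Tendsto (fun y : E × ℂ => ((A y.1 * y.2 + B y.1 : ℂ) : RSphere)) _
      (𝓝 ((A l * w + B l : ℂ) : RSphere))
    have h1 : ContinuousAt (fun y : E × ℂ => A y.1 * y.2 + B y.1) (l, w) := by
      have h2 : ContinuousAt (fun y : E × ℂ => A y.1) (l, w) := hA.comp continuousAt_fst
      have h3 : ContinuousAt (fun y : E × ℂ => B y.1) (l, w) := hB.comp continuousAt_fst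
      exact (h2.mul continuousAt_snd).add h3
    exact (OnePoint.continuous_coe.tendsto _).comp h1

theorem affine_ofChart_infty {a b w : ℂ} (hw : a + b * w ≠ 0) :
    fin (sphInv (affine a b (sphInv (w : RSphere)))) = w / (a + b * w) := by
  by_cases h : w = 0
  · subst h
    have : sphInv ((0 : ℂ) : RSphere) = (∞ : RSphere) := by
      change (if _ then _ else _) = _
      simp
    rw [this, affine_infty]
    change (0 : ℂ) = _
    simp
  · have : sphInv (w : RSphere) = ((w⁻¹ : ℂ) : RSphere) := by
      change (if _ then _ else _) = _
      simp [h]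
    rw [this, affine_coe]
    have h0 : a * w⁻¹ + b ≠ 0 := by
      intro h'
      apply hw
      field_simp at h'
      rw [mul_comm b]; exact (by simpa [mul_comm] using h')
    have : sphInv ((a * w⁻¹ + b : ℂ) : RSphere) = (((a * w⁻¹ + b)⁻¹ : ℂ) : RSphere) := by
      change (if _ then _ else _) = _
      simp [h0]
    rw [this]
    change (a * w⁻¹ + b)⁻¹ = _
    field_simp

/-- Affine maps depend holomorphically on their coefficients, also near `∞`, where in the
coordinate `w = 1 / z` the map `z ↦ a z + b` is `w ↦ w / (a + b w)`. -/
theorem differentiableAt_affine {E : Type*} [NormedAddCommGroup E] [NormedSpace ℂ E]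
    {A B : E → ℂ} {l : E} (hA : DifferentiableAt ℂ A l) (hB : DifferentiableAt ℂ B l)
    (h0 : A l ≠ 0) (z : RSphere) :
    DifferentiableAt ℂ (fun y : E × ℂ =>
      toChart (affine (A l) (B l) z) (affine (A y.1) (B y.1) (ofChart z y.2)))
      (l, toChart z z) := by
  have hA' : ∀ w : ℂ, DifferentiableAt ℂ (fun y : E × ℂ => A y.1) (l, w) :=
    fun w => DifferentiableAt.comp (l, w) hA differentiableAt_fst
  have hB' : ∀ w : ℂ, DifferentiableAt ℂ (fun y : E × ℂ => B y.1) (l, w) :=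
    fun w => DifferentiableAt.comp (l, w) hB differentiableAt_fst
  induction z using OnePoint.rec with
  | infty =>
    change DifferentiableAt ℂ (fun y : E × ℂ =>
      fin (sphInv (affine (A y.1) (B y.1) (sphInv (y.2 : RSphere))))) (l, (0 : ℂ))
    have hD : DifferentiableAt ℂ (fun y : E × ℂ => A y.1 + B y.1 * y.2) (l, (0 : ℂ)) :=
      (hA' 0).add ((hB' 0).mul differentiableAt_snd)
    have hd : DifferentiableAt ℂ (fun y : E × ℂ => y.2 * (A y.1 + B y.1 * y.2)⁻¹) (l, (0 : ℂ)) :=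
      differentiableAt_snd.mul (hD.inv (by simpa using h0))
    refine hd.congr_of_eventuallyEq ?_
    filter_upwards [hD.continuousAt.eventually_ne (y := 0) (by simpa using h0)] with y hy
    exact (affine_ofChart_infty hy).trans (div_eq_mul_inv _ _)
  | coe w =>
    change DifferentiableAt ℂ (fun y : E × ℂ => A y.1 * y.2 + B y.1) (l, w)
    exact ((hA' w).mul differentiableAt_snd).add (hB' w)

/-- Two affine maps with close coefficients are uniformly close for the spherical distance. -/
theorem sphDist_affine_affine_le {a b a' b' : ℂ} (ha : a ≠ 0) (x : RSphere) :
    sphDist (affine a' b' x) (affine a b x) ≤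
      2 * Real.pi * (‖a' - a‖ + ‖b' - b‖) * (1 + (1 + ‖b‖) / ‖a‖) := by
  have hpi := Real.pi_pos
  induction x using OnePoint.rec with
  | infty =>
    rw [affine_infty, affine_infty, sphDist_self]
    positivity
  | coe z =>
    rw [affine_coe, affine_coe]
    refine (sphDist_le_mul_chordalDist _ _).trans ?_
    rw [chordalDist_coe_coe]
    have hp : 0 < ‖a‖ := norm_pos_iff.2 ha
    set t := √(1 + ‖a * z + b‖ ^ 2)
    have ht : 1 ≤ t := one_le_sqrt_one_add_sq _
    have ht' : ‖a * z + b‖ ≤ t := le_sqrt_one_add_sq _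
    set s := √(1 + ‖a' * z + b'‖ ^ 2)
    have hs : 1 ≤ s := one_le_sqrt_one_add_sq _
    have hz : 1 + ‖z‖ ≤ (1 + (1 + ‖b‖) / ‖a‖) * t := by
      have h1 : ‖z‖ ≤ (1 + ‖b‖) / ‖a‖ * t := by
        refine (norm_le_of_affine (b := b) ha).trans ?_
        rw [div_mul_eq_mul_div]
        gcongr
        nlinarith [norm_nonneg b]
      linarith
    have h1 : ‖a' * z + b' - (a * z + b)‖ ≤ (‖a' - a‖ + ‖b' - b‖) * (1 + ‖z‖) := by
      calc ‖a' * z + b' - (a * z + b)‖ = ‖(a' - a) * z + (b' - b)‖ := by ring_nf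
        _ ≤ ‖a' - a‖ * ‖z‖ + ‖b' - b‖ := by
          rw [← norm_mul]; exact norm_add_le _ _
        _ ≤ _ := by nlinarith [norm_nonneg (a' - a), norm_nonneg (b' - b), norm_nonneg z]
    have h2 : 2 * ‖a' * z + b' - (a * z + b)‖ / (s * t) ≤
        2 * ((‖a' - a‖ + ‖b' - b‖) * (1 + (1 + ‖b‖) / ‖a‖)) := by
      rw [div_le_iff₀ (by positivity)]
      calc 2 * ‖a' * z + b' - (a * z + b)‖ ≤ 2 * ((‖a' - a‖ + ‖b' - b‖) * (1 + ‖z‖)) := by gcongr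
        _ ≤ 2 * ((‖a' - a‖ + ‖b' - b‖) * ((1 + (1 + ‖b‖) / ‖a‖) * t)) := by gcongr
        _ = 2 * ((‖a' - a‖ + ‖b' - b‖) * (1 + (1 + ‖b‖) / ‖a‖)) * (1 * t) := by ring
        _ ≤ _ := by gcongr
    calc Real.pi / 2 * (2 * ‖a' * z + b' - (a * z + b)‖ / (s * t)) ≤
        Real.pi / 2 * (2 * ((‖a' - a‖ + ‖b' - b‖) * (1 + (1 + ‖b‖) / ‖a‖))) := by gcongr
      _ = Real.pi * ((‖a' - a‖ + ‖b' - b‖) * (1 + (1 + ‖b‖) / ‖a‖)) := by ring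
      _ ≤ 2 * Real.pi * ((‖a' - a‖ + ‖b' - b‖) * (1 + (1 + ‖b‖) / ‖a‖)) := by
        gcongr
        linarith
      _ = _ := by ring

variable {m : ℕ}

/-! ### Codings of expanding affine systems -/

/-- The shift map `σ` on one-sided sequences. -/
def shift (ω : Words m) : Words m := fun n => ω (n + 1)

theorem continuous_shift : Continuous (shift : Words m → Words m) :=
  continuous_pi fun n => continuous_apply (n + 1)

theorem shift_iterate_apply (ω : Words m) (n k : ℕ) : (shift^[n] ω) k = ω (n + k) := by
  induction n generalizing ω with
  | zero => simp
  | succ n ih =>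
    rw [Function.iterate_succ_apply, ih, shift]
    congr 1
    omega

/-- The function `u` semiconjugates the shift to the maps `z ↦ α i * z + β i`: the map given by
the first letter of `ω` sends `u ω` to `u (σ ω)`. When the maps are expanding, `u ω` is the only
point with a bounded orbit along `ω`. -/
def IsCoding (α β : Fin m → ℂ) (u : C(Words m, ℂ)) : Prop :=
  ∀ ω, u (shift ω) = α (ω 0) * u ω + β (ω 0)

/-- The derivative of `f_{ω_n} ∘ ⋯ ∘ f_{ω_1}` for the maps `f_i = α i * z + β i`. -/
def multiplier (α : Fin m → ℂ) (ω : Words m) (n : ℕ) : ℂ := ∏ k ∈ Finset.range n, α (ω k)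

theorem le_norm_multiplier {α : Fin m → ℂ} {η : ℝ} (hη : 0 ≤ η) (h : ∀ i, η ≤ ‖α i‖)
    (ω : Words m) (n : ℕ) : η ^ n ≤ ‖multiplier α ω n‖ := by
  rw [multiplier, norm_prod]
  calc η ^ n = ∏ k ∈ Finset.range n, η := by simp
    _ ≤ _ := Finset.prod_le_prod (fun _ _ => hη) fun k _ => h _

theorem fiberIter_coe {α β : Fin m → ℂ} {u : C(Words m, ℂ)} (hu : IsCoding α β u) (ω : Words m)
    (n : ℕ) (z : ℂ) : fiberIter (fun i => affine (α i) (β i)) ω n (z : RSphere) =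
      ((multiplier α ω n * (z - u ω) + u (shift^[n] ω) : ℂ) : RSphere) := by
  induction n with
  | zero => simp [fiberIter, multiplier]
  | succ n ih =>
    rw [fiberIter, Function.comp_apply, ih, affine_coe, Function.iterate_succ_apply', hu,
      shift_iterate_apply, multiplier, multiplier, Finset.prod_range_succ, add_zero]
    congr 1
    ring

theorem fiberIter_infty (α β : Fin m → ℂ) (ω : Words m) (n : ℕ) :
    fiberIter (fun i => affine (α i) (β i)) ω n ∞ = (∞ : RSphere) := by
  induction n with
  | zero => rfl
  | succ n ih => rw [fiberIter, Function.comp_apply, ih, affine_infty]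

/-! ### The semigroup as a set of iterates along sequences -/

theorem finite_fiberIter (f : Fin m → RSphere → RSphere) (n : ℕ) :
    {h | ∃ ω, h = fiberIter f ω n}.Finite := by
  induction n with
  | zero => exact (finite_singleton id).subset (by rintro _ ⟨ω, rfl⟩; rfl)
  | succ n ih =>
    refine ((finite_range f).image2 (fun p q => p ∘ q) ih).subset ?_
    rintro _ ⟨ω, rfl⟩
    exact ⟨f (ω n), mem_range_self _, fiberIter f ω n, ⟨ω, rfl⟩, rfl⟩

theorem fiberIter_congr (f : Fin m → RSphere → RSphere) {ω ω' : Words m} {n : ℕ}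
    (h : ∀ k < n, ω k = ω' k) : fiberIter f ω n = fiberIter f ω' n := by
  induction n with
  | zero => rfl
  | succ n ih =>
    rw [fiberIter, fiberIter, h n (Nat.lt_succ_self n),
      ih fun k hk => h k (hk.trans n.lt_succ_self)]

theorem fiberIter_add (f : Fin m → RSphere → RSphere) (ω : Words m) (n k : ℕ) :
    fiberIter f ω (n + k) = fiberIter f (shift^[n] ω) k ∘ fiberIter f ω n := by
  induction k with
  | zero => rfl
  | succ k ih =>
    rw [← add_assoc, fiberIter, ih, fiberIter, shift_iterate_apply, Function.comp_assoc]

theorem semigroup_eq (f : Fin m → RSphere → RSphere) :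
    semigroup f = {h | ∃ ω ∈ (univ : Set (Words m)), ∃ n ≥ 1, h = fiberIter f ω n} := by
  apply Subset.antisymm
  · intro h hh
    refine Subsemigroup.closure_induction (M := Function.End RSphere)
      (p := fun h _ => ∃ ω ∈ (univ : Set (Words m)),
      ∃ n ≥ 1, h = fiberIter f ω n) ?_ ?_ hh
    · rintro _ ⟨i, rfl⟩
      exact ⟨fun _ => i, mem_univ _, 1, le_rfl, rfl⟩
    · rintro _ _ - - ⟨ω, -, n, hn, rfl⟩ ⟨ω', -, k, hk, rfl⟩
      -- the composition follows `k` letters of `ω'`, and then `ω`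
      refine ⟨fun j => if j < k then ω' j else ω (j - k), mem_univ _, k + n, by omega, ?_⟩
      rw [fiberIter_add]
      change fiberIter f ω n ∘ fiberIter f ω' k = _
      congr 1
      · congr 1
        funext j
        rw [shift_iterate_apply]
        simp
      · exact fiberIter_congr f fun j hj => by simp [hj]
  · rintro _ ⟨ω, -, n, hn, rfl⟩
    induction n, hn using Nat.le_induction with
    | base => exact Subsemigroup.subset_closure (M := Function.End RSphere) (mem_range_self (ω 0))
    | succ n hn ih =>
      exact Subsemigroup.mul_mem (M := Function.End RSphere) _
        (Subsemigroup.subset_closure (mem_range_self (ω n))) ih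

/-! ### Normality -/

/-- A family is normal on a set on which it tends to `∞` uniformly: a sequence in the family takes
some value infinitely often, or each value finitely many times. -/
theorem normalOn_of_finite {F : Set (RSphere → RSphere)} {V : Set RSphere}
    (h : ∀ ε > 0, {p ∈ F | ∃ z ∈ V, ε ≤ sphDist (p z) ∞}.Finite) : NormalOn F V := by
  intro v hv
  by_cases hc : ∃ p, ∃ᶠ n in atTop, v n = p
  · obtain ⟨p, hp⟩ := hc
    obtain ⟨φ, hφ, hφ'⟩ := extraction_of_frequently_atTop hp
    refine ⟨φ, hφ, p, fun K _ _ ε hε => Eventually.of_forall fun n z _ => ?_⟩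
    rw [hφ', sphDist_self]
    exact hε
  · push Not at hc
    refine ⟨id, strictMono_id, fun _ => ∞, fun K hK _ ε hε => ?_⟩
    have : ∀ᶠ n in atTop, ∀ p ∈ {p ∈ F | ∃ z ∈ V, ε ≤ sphDist (p z) ∞}, v n ≠ p :=
      (eventually_all_finite (h ε hε)).2 fun p _ => hc p
    filter_upwards [this] with n hn z hz
    by_contra hlt
    exact hn (v n) ⟨hv n, z, hK hz, not_lt.1 hlt⟩ rfl

section Coding

variable {α β : Fin m → ℂ} {u : C(Words m, ℂ)} {η : ℝ}

/-- Far from the points `u ω`, all the long enough compositions are close to `∞`. -/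
theorem normalOn_of_separated (hu : IsCoding α β u) (hη : 1 < η) (hα : ∀ i, η ≤ ‖α i‖)
    {W : Set (Words m)} {V : Set RSphere} {δ : ℝ} (hδ : 0 < δ)
    (hV : ∀ z : ℂ, (z : RSphere) ∈ V → ∀ ω ∈ W, δ ≤ ‖z - u ω‖) :
    NormalOn {h | ∃ ω ∈ W, ∃ n ≥ 1, h = fiberIter (fun i => affine (α i) (β i)) ω n} V := by
  refine normalOn_of_finite fun ε hε => ?_
  obtain ⟨N, hN⟩ := ((tendsto_pow_atTop_atTop_of_one_lt hη).atTop_mul_const hδ).eventually_gt_atTop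
    (‖u‖ + Real.pi / ε) |>.exists_forall_of_atTop
  refine ((finite_Iio N).biUnion fun n _ =>
    finite_fiberIter (fun i => affine (α i) (β i)) n).subset ?_
  rintro _ ⟨⟨ω, hω, n, -, rfl⟩, z, hz, hle⟩
  simp only [mem_iUnion, mem_Iio, exists_prop]
  refine ⟨n, ?_, ω, rfl⟩
  by_contra hn
  induction z using OnePoint.rec with
  | infty =>
    rw [fiberIter_infty, sphDist_self] at hle
    linarith
  | coe z =>
    rw [fiberIter_coe hu] at hle
    have h1 := hN n (not_lt.1 hn)
    have h2 : η ^ n * δ ≤ ‖multiplier α ω n * (z - u ω)‖ := by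
      rw [norm_mul]
      exact mul_le_mul (le_norm_multiplier (by linarith) hα _ _) (hV z hz ω hω) hδ.le
        (norm_nonneg _)
    have h3 := norm_sub_le (multiplier α ω n * (z - u ω) + u (shift^[n] ω)) (u (shift^[n] ω))
    rw [add_sub_cancel_right] at h3
    have h4 := u.norm_coe_le_norm (shift^[n] ω)
    set y := multiplier α ω n * (z - u ω) + u (shift^[n] ω)
    have h5 : Real.pi / ε < ‖y‖ := by linarith
    have h6 : 0 < ‖y‖ := lt_trans (by have := Real.pi_pos; positivity) h5
    have h7 := sphDist_coe_infty_le (norm_pos_iff.1 h6)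
    rw [div_lt_iff₀ hε] at h5
    have h8 := hle.trans h7
    rw [le_div_iff₀ h6] at h8
    linarith

/-- A limit of a subsequence of the iterates along `ω` would be `∞` at the points other than
`u ω`; this cannot be uniform near `u ω`, since the iterates take bounded values there. -/
theorem not_normalOn (hu : IsCoding α β u) (hη : 1 < η) (hα : ∀ i, η ≤ ‖α i‖)
    {F : Set (RSphere → RSphere)} {ω : Words m}
    (hF : ∀ n ≥ 1, fiberIter (fun i => affine (α i) (β i)) ω n ∈ F) {V : Set RSphere}
    (hV : IsOpen V) (hω : (u ω : RSphere) ∈ V) : ¬ NormalOn F V := by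
  intro hN
  obtain ⟨φ, hφ, g, hg⟩ := hN (fun n => fiberIter (fun i => affine (α i) (β i)) ω (n + 1))
    fun n => hF _ (by omega)
  obtain ⟨δ, hδ, hδV⟩ := Metric.nhds_basis_closedBall.mem_iff.1
    ((hV.preimage OnePoint.continuous_coe).mem_nhds hω)
  replace hg := hg _ (image_subset_iff.2 hδV)
    ((isCompact_closedBall (u ω) δ).image OnePoint.continuous_coe)
  have hinf : ∀ z ∈ Metric.closedBall (u ω) δ, z ≠ u ω → g z = (∞ : RSphere) := by
    intro z hz hne
    by_contra hgz
    obtain ⟨w, hw⟩ := OnePoint.ne_infty_iff_exists.1 hgz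
    have hs : 0 < 1 / √(1 + ‖w‖ ^ 2) := by positivity
    have hd : 0 < ‖z - u ω‖ := norm_pos_iff.2 (sub_ne_zero.2 hne)
    have hesc := (((tendsto_pow_atTop_atTop_of_one_lt hη).atTop_mul_const hd).comp
      ((tendsto_add_atTop_nat 1).comp hφ.tendsto_atTop)).eventually_ge_atTop
      (‖u‖ + (1 + 2 * ‖w‖))
    obtain ⟨n, hn, hn'⟩ := ((hg _ hs).and hesc).exists
    replace hn := hn z (mem_image_of_mem _ hz)
    simp only [Function.comp_apply] at hn'
    rw [fiberIter_coe hu, ← hw] at hn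
    refine absurd hn (not_lt.2 (one_div_sqrt_le_sphDist ?_))
    have h2 : η ^ (φ n + 1) * ‖z - u ω‖ ≤ ‖multiplier α ω (φ n + 1) * (z - u ω)‖ := by
      rw [norm_mul]
      gcongr
      exact le_norm_multiplier (by linarith) hα _ _
    have h3 := norm_sub_le (multiplier α ω (φ n + 1) * (z - u ω) + u (shift^[φ n + 1] ω))
      (u (shift^[φ n + 1] ω))
    rw [add_sub_cancel_right] at h3
    have h4 := u.norm_coe_le_norm (shift^[φ n + 1] ω)
    linarith
  have hpos : 0 < 2 / (1 + (1 + ‖u‖)) := by positivity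
  obtain ⟨n, hn⟩ := (hg _ hpos).exists
  set M := multiplier α ω (φ n + 1)
  have hM : 1 ≤ ‖M‖ := (one_le_pow₀ hη.le).trans (le_norm_multiplier (by linarith) hα _ _)
  -- a point so close to `u ω` that its image is at distance at most `1` from a point `u ω'`
  set t : ℂ := ((min δ 1 / ‖M‖ : ℝ) : ℂ)
  have hmin : 0 < min δ 1 := lt_min hδ one_pos
  have ht : ‖t‖ = min δ 1 / ‖M‖ := by
    rw [Complex.norm_real, Real.norm_of_nonneg (by positivity)]
  have ht0 : t ≠ 0 := by
    rw [← norm_pos_iff, ht]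
    positivity
  have hz : u ω + t ∈ Metric.closedBall (u ω) δ := by
    rw [Metric.mem_closedBall, dist_eq_norm, add_sub_cancel_left, ht]
    exact (div_le_self hmin.le hM).trans (min_le_left _ _)
  have h1 := hn _ (mem_image_of_mem _ hz)
  rw [hinf _ hz (by simpa using ht0), fiberIter_coe hu] at h1
  refine absurd h1 (not_lt.2 ((div_le_div_of_nonneg_left zero_le_two (by positivity) ?_).trans
    (le_sphDist_coe_infty _)))
  have h2 : ‖M * (u ω + t - u ω)‖ ≤ 1 := by
    rw [add_sub_cancel_left, norm_mul, ht, mul_div_cancel₀ _ (by positivity)]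
    exact min_le_right _ _
  have h3 := norm_add_le (M * (u ω + t - u ω)) (u (shift^[φ n + 1] ω))
  have h4 := u.norm_coe_le_norm (shift^[φ n + 1] ω)
  linarith

theorem normalitySet_eq (hu : IsCoding α β u) (hη : 1 < η) (hα : ∀ i, η ≤ ‖α i‖)
    {W : Set (Words m)} (hW : IsCompact W) :
    normalitySet {h | ∃ ω ∈ W, ∃ n ≥ 1, h = fiberIter (fun i => affine (α i) (β i)) ω n} =
      ((fun ω => (u ω : RSphere)) '' W)ᶜ := by
  have hK : IsCompact (u '' W) := hW.image u.continuous
  apply Subset.antisymm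
  · rintro _ ⟨V, hV, hz, hN⟩ ⟨ω, hω, rfl⟩
    refine not_normalOn hu hη hα (fun n hn => ?_) hV hz hN
    exact ⟨ω, hω, n, hn, rfl⟩
  · intro p hp
    induction p using OnePoint.rec with
    | infty =>
      -- the complement of the closed `1`-neighbourhood of the compact set `u '' W`
      refine ⟨((↑) '' Metric.cthickening 1 (u '' W))ᶜ, ?_, ?_,
        normalOn_of_separated hu hη hα one_pos ?_⟩
      · rw [isOpen_compl_iff]
        exact (hK.cthickening.image OnePoint.continuous_coe).isClosed
      · rintro ⟨z, -, hz⟩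
        exact OnePoint.coe_ne_infty z hz
      · intro z hz ω hω
        by_contra hlt
        refine hz ⟨z, ?_, rfl⟩
        refine Metric.mem_cthickening_of_dist_le z (u ω) 1 _ (mem_image_of_mem _ hω) ?_
        rw [dist_eq_norm]
        exact (not_le.1 hlt).le
    | coe z =>
      have hz : z ∉ u '' W := fun ⟨ω, hω, h⟩ => hp ⟨ω, hω, congrArg _ h⟩
      obtain ⟨δ, hδ, hb⟩ := Metric.mem_nhds_iff.1 (hK.isClosed.isOpen_compl.mem_nhds hz)
      refine ⟨(↑) '' Metric.ball z (δ / 2),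
        OnePoint.isOpenMap_coe _ Metric.isOpen_ball,
        mem_image_of_mem _ (Metric.mem_ball_self (half_pos hδ)),
        normalOn_of_separated hu hη hα (half_pos hδ) ?_⟩
      rintro y ⟨y', hy, hyy⟩ ω hω
      obtain rfl := OnePoint.coe_injective hyy
      by_contra hlt
      refine hb (a := u ω) ?_ (mem_image_of_mem _ hω)
      rw [not_le, ← dist_eq_norm, dist_comm] at hlt
      rw [Metric.mem_ball] at hy ⊢
      linarith [dist_triangle (u ω) y' z]

theorem juliaSet_eq (hu : IsCoding α β u) (hη : 1 < η) (hα : ∀ i, η ≤ ‖α i‖) :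
    juliaSet (fun i => affine (α i) (β i)) = range fun ω => (u ω : RSphere) := by
  rw [juliaSet, fatouSet, semigroup_eq, normalitySet_eq hu hη hα isCompact_univ, compl_compl,
    image_univ]

theorem fiberJulia_eq (hu : IsCoding α β u) (hη : 1 < η) (hα : ∀ i, η ≤ ‖α i‖) (ω : Words m) :
    fiberJulia (fun i => affine (α i) (β i)) ω = {(u ω : RSphere)} := by
  have h := normalitySet_eq hu hη hα (isCompact_singleton (x := ω))
  simp only [mem_singleton_iff, exists_eq_left, image_singleton] at h
  rw [fiberJulia, h, compl_compl]

/-- The Julia set of the skew product is the graph of the coding. -/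
theorem skewJulia_eq (hu : IsCoding α β u) (hη : 1 < η) (hα : ∀ i, η ≤ ‖α i‖) :
    skewJulia (fun i => affine (α i) (β i)) = {x | x.2 = (u x.1 : RSphere)} := by
  rw [skewJulia]
  simp only [fiberJulia_eq hu hη hα, mem_singleton_iff]
  exact (isClosed_eq continuous_snd
    (OnePoint.continuous_coe.comp (u.continuous.comp continuous_fst))).closure_eq

theorem sphDerivNorm_fiberIter (hu : IsCoding α β u) (ω : Words m) (n : ℕ) (z : ℂ) :
    sphDerivNorm (fiberIter (fun i => affine (α i) (β i)) ω n) z = ‖multiplier α ω n‖ *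
      ((1 + ‖z‖ ^ 2) / (1 + ‖multiplier α ω n * (z - u ω) + u (shift^[n] ω)‖ ^ 2)) := by
  unfold sphDerivNorm
  rw [fiberIter_coe hu]
  change ‖deriv (fun w : ℂ => fin (fiberIter (fun i => affine (α i) (β i)) ω n (w : RSphere))) z‖
    * ((1 + ‖z‖ ^ 2) / (1 + ‖multiplier α ω n * (z - u ω) + u (shift^[n] ω)‖ ^ 2)) = _
  congr 2
  have : (fun w : ℂ => fin (fiberIter (fun i => affine (α i) (β i)) ω n (w : RSphere))) =
      fun w => multiplier α ω n * (w - u ω) + u (shift^[n] ω) := by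
    funext w
    rw [fiberIter_coe hu]
    rfl
  rw [this]
  simp

theorem mem_expSet (hm : 0 < m) (hu : IsCoding α β u) (hη : 1 < η) (hα : ∀ i, η ≤ ‖α i‖) :
    (fun i => affine (α i) (β i)) ∈ ExpSet m := by
  refine ⟨fun j => affine_mem_ratMaps (norm_pos_iff.1 (by linarith [hα j])) _, ?_, η, hη,
    1 / (1 + ‖u‖ ^ 2), ⟨by positivity, ?_⟩, ?_⟩
  · rw [juliaSet_eq hu hη hα]
    exact ⟨_, fun _ => ⟨0, hm⟩, rfl⟩
  · rw [div_le_one (by positivity)]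
    nlinarith
  · rintro n - ⟨ω, z⟩ hx
    rw [skewJulia_eq hu hη hα] at hx
    obtain rfl : z = (u ω : RSphere) := hx
    dsimp only
    rw [sphDerivNorm_fiberIter hu, sub_self, mul_zero, zero_add, mul_comm]
    have h1 := le_norm_multiplier (by linarith) hα ω n
    have h2 := u.norm_coe_le_norm (shift^[n] ω)
    gcongr
    nlinarith

end Coding

/-! ### Holomorphic dependence of the coding on the coefficients -/

/-- The indicator function of the sequences with first letter `i`. -/
def cylinderIndicator (i : Fin m) : C(Words m, ℂ) where
  toFun ω := if ω 0 = i then 1 else 0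
  continuous_toFun := (continuous_of_discreteTopology (f := fun k : Fin m =>
    if k = i then (1 : ℂ) else 0)).comp (continuous_apply 0)

/-- The operator sending `u` to `u ∘ σ` on the sequences with first letter `i`, and to `0` on the
other sequences. -/
noncomputable def cylinderShift (i : Fin m) : C(Words m, ℂ) →L[ℂ] C(Words m, ℂ) :=
  LinearMap.mkContinuous
    { toFun := fun u => cylinderIndicator i * u.comp ⟨shift, continuous_shift⟩
      map_add' := fun u v => by ext; simp [mul_add]
      map_smul' := fun c u => by ext; simp } 1 fun u => by
    rw [one_mul, ContinuousMap.norm_le _ (norm_nonneg _)]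
    intro ω
    change ‖(if ω 0 = i then (1 : ℂ) else 0) * u (shift ω)‖ ≤ ‖u‖
    have := u.norm_coe_le_norm (shift ω)
    split_ifs
    · simpa using this
    · simp

theorem cylinderShift_apply (i : Fin m) (u : C(Words m, ℂ)) (ω : Words m) :
    cylinderShift i u ω = if ω 0 = i then u (shift ω) else 0 := by
  change (if ω 0 = i then (1 : ℂ) else 0) * u (shift ω) = _
  split_ifs <;> simp

/-- The linear part of the affine operator `u ↦ (ω ↦ (u (σ ω) - b) / a)`, where `a z + b` is the
map given by the first letter of `ω`. The fixed points of the affine operator are the codings. -/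
noncomputable def codingOp (l : AffineParam m) : C(Words m, ℂ) →L[ℂ] C(Words m, ℂ) :=
  ∑ i, (l (i, 0))⁻¹ • cylinderShift i

/-- The constant part of the affine operator whose fixed points are the codings. -/
noncomputable def codingConst (l : AffineParam m) : C(Words m, ℂ) :=
  ∑ i, (-(l (i, 1)) * (l (i, 0))⁻¹) • cylinderIndicator i

theorem codingOp_apply (l : AffineParam m) (u : C(Words m, ℂ)) (ω : Words m) :
    codingOp l u ω = (l (ω 0, 0))⁻¹ * u (shift ω) := by
  simp [codingOp, cylinderShift_apply]

theorem codingConst_apply (l : AffineParam m) (ω : Words m) :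
    codingConst l ω = -(l (ω 0, 1)) * (l (ω 0, 0))⁻¹ := by
  simp [codingConst, cylinderIndicator]

/-- The coding of the expanding affine system with coefficients `l`: the solution of
`u = codingOp l u + codingConst l`. -/
noncomputable def coding (l : AffineParam m) : C(Words m, ℂ) :=
  Ring.inverse (1 - codingOp l) (codingConst l)

theorem isUnit_one_sub_codingOp {l : AffineParam m} {η : ℝ} (hη : 1 < η)
    (hl : ∀ i, η ≤ ‖l (i, 0)‖) : IsUnit (1 - codingOp l) := by
  have h0 : 0 < η := by linarith
  refine isUnit_one_sub_of_norm_lt_one (R := C(Words m, ℂ) →L[ℂ] C(Words m, ℂ))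
    (lt_of_le_of_lt (b := η⁻¹) ?_ (inv_lt_one_of_one_lt₀ hη))
  refine ContinuousLinearMap.opNorm_le_bound _ (by positivity) fun u => ?_
  rw [ContinuousMap.norm_le _ (by positivity)]
  intro ω
  rw [codingOp_apply, norm_mul, norm_inv]
  have := u.norm_coe_le_norm (shift ω)
  gcongr
  exact hl _

theorem isCoding_coding {l : AffineParam m} {η : ℝ} (hη : 1 < η) (hl : ∀ i, η ≤ ‖l (i, 0)‖) :
    IsCoding (fun i => l (i, 0)) (fun i => l (i, 1)) (coding l) := by
  intro ω
  have h : (1 - codingOp l) (coding l) = codingConst l := by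
    have := Ring.mul_inverse_cancel _ (isUnit_one_sub_codingOp hη hl)
    exact congrArg (fun T : C(Words m, ℂ) →L[ℂ] C(Words m, ℂ) => T (codingConst l)) this
  have h' := congrArg (fun u : C(Words m, ℂ) => u ω) h
  simp only [_root_.sub_apply, one_apply_eq_self,
    ContinuousMap.sub_apply, codingOp_apply, codingConst_apply] at h'
  have h0 : l (ω 0, 0) ≠ 0 := norm_pos_iff.1 (by linarith [hl (ω 0)])
  field_simp at h'
  linear_combination -h'

theorem contDiff_apply_affineParam (k : Fin m × Fin 2) :
    ContDiff ℂ 1 (fun l : AffineParam m => l k) :=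
  (EuclideanSpace.proj (𝕜 := ℂ) k).contDiff

theorem contDiffAt_coding {l : AffineParam m} {η : ℝ} (hη : 1 < η) (hl : ∀ i, η ≤ ‖l (i, 0)‖) :
    ContDiffAt ℂ 1 coding l := by
  have h0 : ∀ i, l (i, 0) ≠ 0 := fun i => norm_pos_iff.1 (by linarith [hl i])
  have hi : ∀ i, ContDiffAt ℂ 1 (fun x : AffineParam m => (x (i, 0))⁻¹) l := fun i =>
    (contDiff_apply_affineParam (i, 0)).contDiffAt.inv (h0 i)
  have hop : ContDiffAt ℂ 1 (fun x : AffineParam m => 1 - codingOp x) l :=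
    contDiffAt_const.sub (ContDiffAt.sum fun i _ => (hi i).smul contDiffAt_const)
  have hc : ContDiffAt ℂ 1 (codingConst : AffineParam m → _) l :=
    ContDiffAt.sum fun i _ => ((contDiff_apply_affineParam (i, 1)).contDiffAt.neg.mul
      (hi i)).smul contDiffAt_const
  obtain ⟨U, hU⟩ := isUnit_one_sub_codingOp hη hl
  have hr := contDiffAt_ringInverse ℂ (n := 1) (R := C(Words m, ℂ) →L[ℂ] C(Words m, ℂ)) U
  rw [hU] at hr
  exact (hr.comp l hop).clm_apply hc

/-- The derivative of the coding satisfies the derivative of the semiconjugacy equation. -/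
theorem fderiv_coding_shift {l : AffineParam m} {η : ℝ} (hη : 1 < η) (hl : ∀ i, η < ‖l (i, 0)‖)
    {D : AffineParam m →L[ℂ] C(Words m, ℂ)} (hD : HasFDerivAt coding D l) (ω : Words m)
    (v : AffineParam m) :
    D v (shift ω) = l (ω 0, 0) * D v ω + v (ω 0, 0) * coding l ω + v (ω 0, 1) := by
  have hev : ∀ ω, HasFDerivAt (fun x : AffineParam m => coding x ω)
      ((ContinuousMap.evalCLM ℂ ω).comp D) l := fun ω =>
    (ContinuousMap.evalCLM ℂ ω : C(Words m, ℂ) →L[ℂ] ℂ).hasFDerivAt.comp l hD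
  have hp : ∀ k, HasFDerivAt (fun x : AffineParam m => x k)
      (EuclideanSpace.proj (𝕜 := ℂ) k : AffineParam m →L[ℂ] ℂ) l := fun k =>
    (EuclideanSpace.proj (𝕜 := ℂ) k).hasFDerivAt
  have h1 := ((hp (ω 0, 0)).mul (hev ω)).add (hp (ω 0, 1))
  have h2 : (fun x : AffineParam m => coding x (shift ω)) =ᶠ[𝓝 l]
      fun x => x (ω 0, 0) * coding x ω + x (ω 0, 1) := by
    have : ∀ᶠ x in 𝓝 l, ∀ i, η < ‖x (i, 0)‖ := eventually_all.2 fun i =>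
      ((contDiff_apply_affineParam (i, 0)).continuous.norm.continuousAt).eventually_const_lt (hl i)
    filter_upwards [this] with x hx
    exact isCoding_coding hη (fun i => (hx i).le) ω
  have h3 := (hev (shift ω)).unique (h1.congr_of_eventuallyEq h2)
  have h4 := congrArg (fun T : AffineParam m →L[ℂ] ℂ => T v) h3
  simpa [mul_comm] using h4

end RatSemi

/-! ### Covering by balls -/

/-- A set is covered by as many balls as there are cells, if points of the set in a common cell
are close. -/
theorem exists_cover_of_cells {E T : Type*} [PseudoMetricSpace E] {F : Set E} {r : ℝ}
    (cell : E → T) (S : Finset T) (hS : ∀ x ∈ F, cell x ∈ S)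
    (hcell : ∀ x ∈ F, ∀ y ∈ F, cell x = cell y → dist x y < r) :
    ∃ c : Finset E, F ⊆ ⋃ y ∈ c, Metric.ball y r ∧ c.card ≤ S.card := by
  classical
  rcases F.eq_empty_or_nonempty with rfl | ⟨x₀, -⟩
  · exact ⟨∅, empty_subset _, Nat.zero_le _⟩
  have : Nonempty E := ⟨x₀⟩
  refine ⟨S.image (Function.invFunOn cell F), fun x hx => ?_, Finset.card_image_le⟩
  have h : ∃ y ∈ F, cell y = cell x := ⟨x, hx, rfl⟩
  refine mem_biUnion (Finset.mem_image_of_mem _ (hS x hx)) ?_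
  exact hcell x hx _ (Function.invFunOn_mem h) (Function.invFunOn_eq h).symm

theorem floor_mem_Icc_of_abs_le {t T : ℝ} (h : |t| ≤ T) : ⌊t⌋ ∈ Finset.Icc ⌊-T⌋ ⌊T⌋ :=
  Finset.mem_Icc.2 ⟨Int.floor_le_floor (abs_le.1 h).1, Int.floor_le_floor (abs_le.1 h).2⟩

theorem card_Icc_floor_le {T : ℝ} (hT : 0 ≤ T) :
    ((Finset.Icc ⌊-T⌋ ⌊T⌋).card : ℝ) ≤ 2 * T + 2 := by
  rw [Int.card_Icc]
  have h1 : ⌊-T⌋ ≤ ⌊T⌋ + 1 := (Int.floor_le_floor (by linarith)).trans (by omega)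
  have h2 : (((⌊T⌋ + 1 - ⌊-T⌋).toNat : ℤ) : ℝ) = ((⌊T⌋ + 1 - ⌊-T⌋ : ℤ) : ℝ) := by
    rw [Int.toNat_of_nonneg (by omega)]
  rw [Int.cast_natCast] at h2
  rw [h2]
  push_cast
  linarith [Int.floor_le T, Int.lt_floor_add_one (-T)]

theorem abs_sub_lt_of_floor_div_eq {s t δ : ℝ} (hδ : 0 < δ) (h : ⌊s / δ⌋ = ⌊t / δ⌋) :
    |s - t| < δ := by
  have := Int.abs_sub_lt_one_of_floor_eq_floor h
  rwa [← sub_div, abs_div, abs_of_pos hδ, div_lt_one hδ] at this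

/-- Let `Φ` be an expanding map from a set to `ℂ^n`, with bounded values, one coordinate of which
has size `O(r)`. The set is covered by `O(r ^ (2 - 2 * n))` balls of radius `r`: this is the
number of cubes of size about `r` which can meet its image. -/
theorem exists_cover_of_expanding {E κ : Type*} [SeminormedAddCommGroup E] [Fintype κ]
    [DecidableEq κ] {F : Set E} {A R B r : ℝ} (hA : 0 ≤ A) (hR : 0 ≤ R) (hr : 0 < r) (hrB : r ≤ B)
    (Φ : E → κ → ℂ) (hΦ : ∀ x ∈ F, ∀ y ∈ F, ‖x - y‖ ≤ A * ∑ j, ‖Φ x j - Φ y j‖)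
    (hb : ∀ x ∈ F, ∀ j, ‖Φ x j‖ ≤ R) (k : κ) (hk : ∀ x ∈ F, ‖Φ x k‖ ≤ R * r) :
    ∃ c : Finset E, F ⊆ ⋃ y ∈ c, Metric.ball y r ∧ (c.card : ℝ) ≤
      (2 * R * (2 * A * Fintype.card κ + 1) + 2 + 2 * B) ^ (2 * Fintype.card κ) *
        r ^ (2 - 2 * (Fintype.card κ : ℤ)) := by
  set n := Fintype.card κ
  set s : ℝ := 2 * A * n + 1
  have hs0 : 0 < s := by positivity
  have hδ : 0 < r / s := by positivity
  set M : ℝ := 2 * R * s + 2 + 2 * B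
  have hM : 0 ≤ M := by have := hr.le.trans hrB; positivity
  -- the bound for the `j`-th coordinate
  let T : κ → ℝ := fun j => if j = k then R * r else R
  have hT : ∀ j, 0 ≤ T j := fun j => by dsimp only [T]; split_ifs <;> positivity
  have hΦT : ∀ x ∈ F, ∀ j, ‖Φ x j‖ ≤ T j := fun x hx j => by
    dsimp only [T]
    split_ifs with h
    · rw [h]; exact hk x hx
    · exact hb x hx j
  let I : κ → Finset ℤ := fun j => Finset.Icc ⌊-(T j / (r / s))⌋ ⌊T j / (r / s)⌋
  let cell : E → κ → ℤ × ℤ :=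
    fun x j => (⌊(Φ x j).re / (r / s)⌋, ⌊(Φ x j).im / (r / s)⌋)
  have hS : ∀ x ∈ F, cell x ∈ Fintype.piFinset fun j => I j ×ˢ I j := by
    intro x hx
    rw [Fintype.mem_piFinset]
    intro j
    have h := hΦT x hx j
    refine Finset.mem_product.2 ⟨floor_mem_Icc_of_abs_le ?_, floor_mem_Icc_of_abs_le ?_⟩
    · rw [abs_div, abs_of_pos hδ]
      gcongr
      exact (Complex.abs_re_le_norm _).trans h
    · rw [abs_div, abs_of_pos hδ]
      gcongr
      exact (Complex.abs_im_le_norm _).trans h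
  have hcell : ∀ x ∈ F, ∀ y ∈ F, cell x = cell y → dist x y < r := by
    intro x hx y hy hxy
    have hj : ∀ j, ‖Φ x j - Φ y j‖ ≤ 2 * (r / s) := by
      intro j
      have h := Prod.mk.inj (congrFun hxy j)
      have h1 := abs_sub_lt_of_floor_div_eq hδ h.1
      have h2 := abs_sub_lt_of_floor_div_eq hδ h.2
      have h3 := Complex.norm_le_abs_re_add_abs_im (Φ x j - Φ y j)
      rw [Complex.sub_re, Complex.sub_im] at h3
      linarith
    rw [dist_eq_norm]
    calc ‖x - y‖ ≤ A * ∑ j, ‖Φ x j - Φ y j‖ := hΦ x hx y hy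
      _ ≤ A * ∑ _j : κ, 2 * (r / s) := by gcongr with j; exact hj j
      _ = r * ((2 * A * n) / s) := by
        rw [Finset.sum_const, Finset.card_univ, nsmul_eq_mul]
        ring
      _ < r := by
        refine mul_lt_of_lt_one_right hr ((div_lt_one hs0).2 ?_)
        linarith
  obtain ⟨c, hc, hcard⟩ := exists_cover_of_cells cell _ hS hcell
  refine ⟨c, hc, (Nat.cast_le.2 hcard).trans ?_⟩
  rw [Fintype.card_piFinset]
  push_cast
  simp only [Finset.card_product]
  have hI : ∀ j, ((I j).card : ℝ) ≤ if j = k then M else M / r := by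
    intro j
    refine (card_Icc_floor_le (div_nonneg (hT j) hδ.le)).trans ?_
    dsimp only [T]
    split_ifs
    · have : R * r / (r / s) = R * s := by field_simp
      rw [this]
      have := hr.le.trans hrB
      simp only [M]
      linarith
    · rw [le_div_iff₀ hr]
      have : (2 * (R / (r / s)) + 2) * r = 2 * R * s + 2 * r := by field_simp
      rw [this]
      simp only [M]
      linarith
  calc ∏ j, (((I j).card * (I j).card : ℕ) : ℝ)
      ≤ ∏ j, (if j = k then M else M / r) ^ 2 := by
        refine Finset.prod_le_prod (fun _ _ => by positivity) fun j _ => ?_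
        rw [Nat.cast_mul, ← sq]
        exact pow_le_pow_left₀ (by positivity) (hI j) 2
    _ = M ^ 2 * ((M / r) ^ 2) ^ (n - 1) := by
        rw [← Finset.mul_prod_erase _ _ (Finset.mem_univ k), if_pos rfl,
          Finset.prod_congr rfl (g := fun _ => (M / r) ^ 2), Finset.prod_const,
          Finset.card_erase_of_mem (Finset.mem_univ k), Finset.card_univ]
        intro j hj
        rw [if_neg (Finset.ne_of_mem_erase hj)]
    _ = M ^ (2 * n) * r ^ (2 - 2 * (n : ℤ)) := by
        have hn : 1 ≤ n := Fintype.card_pos_iff.2 ⟨k⟩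
        have e1 : (2 - 2 * (n : ℤ)) = -((2 * (n - 1) : ℕ) : ℤ) := by
          push_cast [hn]
          ring
        rw [e1, zpow_neg, zpow_natCast, ← pow_mul, div_pow, ← mul_div_assoc, ← pow_add,
          show 2 + 2 * (n - 1) = 2 * n by omega, div_eq_mul_inv]

theorem volume_le_of_cover {E : Type*} [NormedAddCommGroup E] [InnerProductSpace ℝ E]
    [FiniteDimensional ℝ E] [MeasurableSpace E] [BorelSpace E] [Nontrivial E] {F : Set E} {r N : ℝ}
    (hr : 0 < r) (hN : 0 ≤ N) {c : Finset E} (hF : F ⊆ ⋃ y ∈ c, Metric.ball y r)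
    (hc : (c.card : ℝ) ≤ N) :
    volume F ≤ ENNReal.ofReal ((volume (Metric.ball (0 : E) 1)).toReal * N *
      r ^ Module.finrank ℝ E) := by
  calc volume F ≤ ∑ y ∈ c, volume (Metric.ball y r) :=
        (measure_mono hF).trans (measure_biUnion_finset_le _ _)
    _ = c.card * (ENNReal.ofReal (r ^ Module.finrank ℝ E) * volume (Metric.ball (0 : E) 1)) := by
        simp only [Measure.addHaar_ball volume _ hr.le, Finset.sum_const, nsmul_eq_mul]
    _ ≤ ENNReal.ofReal N * (ENNReal.ofReal (r ^ Module.finrank ℝ E) *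
        ENNReal.ofReal (volume (Metric.ball (0 : E) 1)).toReal) := by
        rw [ENNReal.ofReal_toReal measure_ball_lt_top.ne]
        gcongr
        rw [← ENNReal.ofReal_natCast]
        exact ENNReal.ofReal_le_ofReal hc
    _ = _ := by
        rw [← ENNReal.ofReal_mul (by positivity), ← ENNReal.ofReal_mul hN]
        congr 1
        ring

theorem RatSemi.ballCoveringNumber_le_of_cover {E : Type*} [PseudoMetricSpace E] {F : Set E}
    {r N : ℝ} {c : Finset E} (hF : F ⊆ ⋃ y ∈ c, Metric.ball y r) (hc : (c.card : ℝ) ≤ N) :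
    (ballCoveringNumber r F : ℝ≥0∞) ≤ ENNReal.ofReal N := by
  calc (ballCoveringNumber r F : ℝ≥0∞) ≤ ((c.card : ℕ∞) : ℝ≥0∞) :=
        ENat.toENNReal_le.2 (iInf₂_le c hF)
    _ = ENNReal.ofReal c.card := by rw [ENat.toENNReal_coe, ENNReal.ofReal_natCast]
    _ ≤ _ := ENNReal.ofReal_le_ofReal hc

namespace RatSemi

variable {m : ℕ}

/-! ### The gradient at a collision -/

/-- If no map sends the fixed point of another one into the range of `u`, then the fixed point of
the `i`-th map has the constant sequence `i` as its only code. -/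
theorem eq_const_of_coding_eq {α β : Fin m → ℂ} {u : C(Words m, ℂ)} (hu : IsCoding α β u)
    (hfix : ∀ j k, j ≠ k → ∀ ω, α k * u (fun _ => j) + β k ≠ u ω) {i : Fin m} {ω : Words m}
    (h : u ω = u fun _ => i) : ω = fun _ => i := by
  have h0 : ∀ ω : Words m, u ω = (u fun _ => i) → ω 0 = i := by
    intro ω h
    by_contra hne
    refine hfix i (ω 0) (Ne.symm hne) (shift ω) ?_
    rw [hu, h]
  have hn : ∀ n, u (shift^[n] ω) = u fun _ => i := by
    intro n
    induction n with
    | zero => exact h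
    | succ n ih =>
      rw [Function.iterate_succ_apply', hu, h0 _ ih, ih]
      exact (hu fun _ => i).symm
  funext n
  rw [← h0 _ (hn n), shift_iterate_apply, add_zero]

/-- At a collision `u ω = u ω'` with `ω₁ = i ≠ j = ω'₁`, the sequences are `ω = i p p p …` and
`ω' = j q q q …` with `p ≠ i` and `q ≠ j`. If the derivatives of `u ω` and `u ω'` along the
constant terms of the `i`-th and the `j`-th map agree, then `q = i` and `p = j`, and `α i`, `α j`
are related in such a way that the derivatives along the linear coefficient of the `i`-th map
agree only if `u ω` is the fixed point of the `i`-th map, which the `j`-th map would leave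
fixed. -/
theorem exists_derivative_ne {α β : Fin m → ℂ} {u : C(Words m, ℂ)} (hu : IsCoding α β u)
    (h0 : ∀ i, α i ≠ 0) (h1 : ∀ i, α i ≠ 1) {D : AffineParam m →L[ℂ] C(Words m, ℂ)}
    (hD : ∀ v ω, D v (shift ω) = α (ω 0) * D v ω + v (ω 0, 0) * u ω + v (ω 0, 1))
    (hcol : ∀ ω ω', ω 0 ≠ ω' 0 → u ω = u ω' → ∃ p, u (shift ω) = u fun _ => p)
    (hfix : ∀ j k, j ≠ k → ∀ ω, α k * u (fun _ => j) + β k ≠ u ω)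
    {ω ω' : Words m} (hne : ω 0 ≠ ω' 0) (h : u ω = u ω') :
    ∃ k, D (EuclideanSpace.single k 1) ω ≠ D (EuclideanSpace.single k 1) ω' := by
  obtain ⟨p, hp⟩ := hcol ω ω' hne h
  obtain ⟨q, hq⟩ := hcol ω' ω hne.symm h.symm
  have hp' := eq_const_of_coding_eq hu hfix hp
  have hq' := eq_const_of_coding_eq hu hfix hq
  set i := ω 0
  set j := ω' 0
  -- the point of the collision, and its images by the two maps
  have ep : (u fun _ => p) = α i * u ω + β i := by rw [← hp]; exact hu ω
  have eq : (u fun _ => q) = α j * u ω + β j := by rw [h, ← hq]; exact hu ω'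
  have hconst : ∀ k, (u fun _ => k) = α k * (u fun _ => k) + β k := fun k => hu fun _ => k
  have hpi : p ≠ i := by
    rintro hpi
    rw [hpi] at ep
    have hzi : u ω = u fun _ => i := by
      refine mul_left_cancel₀ (h0 i) ?_
      linear_combination hconst i - ep
    refine hfix i j hne (fun _ => q) ?_
    rw [eq, hzi]
  have hqj : q ≠ j := by
    rintro hqj
    rw [hqj] at eq
    have hzj : u ω = u fun _ => j := by
      refine mul_left_cancel₀ (h0 j) ?_
      linear_combination hconst j - eq
    refine hfix j i hne.symm (fun _ => p) ?_
    rw [ep, hzj]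
  by_contra! hk
  have dω : ∀ v, (D v fun _ => p) = α i * D v ω + v (i, 0) * u ω + v (i, 1) := fun v => by
    rw [← hp']; exact hD v ω
  have dω' : ∀ v, (D v fun _ => q) = α j * D v ω' + v (j, 0) * u ω + v (j, 1) := fun v => by
    rw [← hq', h]; exact hD v ω'
  have dc : ∀ v k, (D v fun _ => k) = α k * (D v fun _ => k) + v (k, 0) * (u fun _ => k) +
    v (k, 1) := fun v k => hD v fun _ => k
  -- the fixed point of a map does not depend on the coefficients of the other maps
  have dc0 : ∀ v : AffineParam m, ∀ k, v (k, 0) = 0 → v (k, 1) = 0 → (D v fun _ => k) = 0 := by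
    intro v k hv0 hv1
    have hc := dc v k
    rw [hv0, hv1] at hc
    refine mul_left_cancel₀ (sub_ne_zero.2 (h1 k)) ?_
    linear_combination -hc
  have hqi : q = i := by
    by_contra hqi
    have e1 := dω (EuclideanSpace.single (i, 1) 1)
    have e2 := dω' (EuclideanSpace.single (i, 1) 1)
    have e3 := hk (i, 1)
    rw [dc0 _ _ (by simp) (by simp [hpi])] at e1
    rw [dc0 _ _ (by simp) (by simp [hqi])] at e2
    simp [hne.symm, h0] at e1 e2
    rw [e3, e2] at e1
    simp at e1
  have hpj : p = j := by
    by_contra hpj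
    have e1 := dω (EuclideanSpace.single (j, 1) 1)
    have e2 := dω' (EuclideanSpace.single (j, 1) 1)
    have e3 := hk (j, 1)
    rw [dc0 _ _ (by simp) (by simp [hpj])] at e1
    rw [dc0 _ _ (by simp) (by simp [hqj])] at e2
    simp [hne, h0] at e1 e2
    rw [← e3, e1] at e2
    simp at e2
  subst hqi
  have hrel : α j * (α i - 1) = α i := by
    have e1 := dω (EuclideanSpace.single (i, 1) 1)
    have e2 := dω' (EuclideanSpace.single (i, 1) 1)
    have e3 := hk (i, 1)
    have e4 := dc (EuclideanSpace.single (i, 1) 1) i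
    rw [dc0 _ _ (by simp) (by simp [hpi])] at e1
    simp [hne.symm] at e1 e2 e4
    rw [e3] at e1
    rw [e2] at e4
    generalize D (EuclideanSpace.single (i, 1) 1) ω' = y at *
    -- `α i * y = -1` and `α j * y * (α i - 1) = -1`
    have hy : y ≠ 0 := by
      rintro rfl
      simp at e1
    refine mul_left_cancel₀ hy ?_
    linear_combination -e4 + e1
  have hzi : u ω = u fun _ => i := by
    have e1 := dω (EuclideanSpace.single (i, 0) 1)
    have e2 := dω' (EuclideanSpace.single (i, 0) 1)
    have e3 := hk (i, 0)
    have e4 := dc (EuclideanSpace.single (i, 0) 1) i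
    rw [dc0 _ _ (by simp [hpi]) (by simp)] at e1
    simp [hne.symm] at e1 e2 e4
    rw [e3] at e1
    rw [e2] at e4
    linear_combination -e1 + e4 + D (EuclideanSpace.single (i, 0) 1) ω' * hrel
  exact hfix i j hne (fun _ => i) (by rw [← hzi, ← eq, hzi])

end RatSemi

/-! ### Uniform transversality near a parameter -/

theorem EuclideanSpace.eq_sum_smul_single {κ : Type*} [Fintype κ] [DecidableEq κ]
    (v : EuclideanSpace ℂ κ) : v = ∑ j, v j • EuclideanSpace.single j (1 : ℂ) := by
  ext i
  simp [Pi.single_apply]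

theorem EuclideanSpace.norm_le_sum_norm {κ : Type*} [Fintype κ] [DecidableEq κ]
    (v : EuclideanSpace ℂ κ) : ‖v‖ ≤ ∑ j, ‖v j‖ := by
  calc ‖v‖ = ‖∑ j, v j • EuclideanSpace.single j (1 : ℂ)‖ := by
        rw [← EuclideanSpace.eq_sum_smul_single]
    _ ≤ ∑ j, ‖v j • EuclideanSpace.single j (1 : ℂ)‖ := norm_sum_le _ _
    _ = _ := by simp [norm_smul]

section Transversality

variable {Ω κ : Type*} [TopologicalSpace Ω] [Fintype κ] [DecidableEq κ]
  {u : EuclideanSpace ℂ κ → C(Ω, ℂ)} {l₀ : EuclideanSpace ℂ κ}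
  {D : EuclideanSpace ℂ κ →L[ℂ] C(Ω, ℂ)}

theorem exists_pos_le_norm_or_derivative {S : Set (Ω × Ω)} (hS : IsCompact S)
    (hcol : ∀ p ∈ S, u l₀ p.1 = u l₀ p.2 →
      ∃ k, D (EuclideanSpace.single k 1) p.1 ≠ D (EuclideanSpace.single k 1) p.2) :
    ∃ c > 0, ∀ p ∈ S, c ≤ ‖u l₀ p.1 - u l₀ p.2‖ ∨
      ∃ k, c ≤ ‖D (EuclideanSpace.single k 1) p.1 - D (EuclideanSpace.single k 1) p.2‖ := by
  have hc : ∀ w : C(Ω, ℂ), Continuous fun p : Ω × Ω => ‖w p.1 - w p.2‖ := fun w =>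
    ((w.continuous.comp continuous_fst).sub (w.continuous.comp continuous_snd)).norm
  obtain ⟨c, hc0, hcS⟩ := hS.exists_forall_le' (a := 0)
    (f := fun p => ‖u l₀ p.1 - u l₀ p.2‖ +
      ∑ k, ‖D (EuclideanSpace.single k 1) p.1 - D (EuclideanSpace.single k 1) p.2‖)
    ((hc _).add (continuous_finsetSum _ fun k _ => hc _)).continuousOn (by
      intro p hp
      by_cases h : u l₀ p.1 = u l₀ p.2
      · obtain ⟨k, hk⟩ := hcol p hp h
        refine add_pos_of_nonneg_of_pos (norm_nonneg _) ?_
        exact Finset.sum_pos' (fun _ _ => norm_nonneg _)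
          ⟨k, Finset.mem_univ _, norm_pos_iff.2 (sub_ne_zero.2 hk)⟩
      · exact add_pos_of_pos_of_nonneg (norm_pos_iff.2 (sub_ne_zero.2 h))
          (Finset.sum_nonneg fun _ _ => norm_nonneg _))
  refine ⟨c / (Fintype.card κ + 1), by positivity, fun p hp => ?_⟩
  by_contra! hlt
  obtain ⟨h1, h2⟩ := hlt
  have h3 : ∑ k, ‖D (EuclideanSpace.single k 1) p.1 - D (EuclideanSpace.single k 1) p.2‖ ≤
      Fintype.card κ * (c / (Fintype.card κ + 1)) := by
    refine (Finset.sum_le_sum fun k _ => (h2 k).le).trans_eq ?_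
    rw [Finset.sum_const, Finset.card_univ, nsmul_eq_mul]
  have h4 := hcS p hp
  have h5 : (Fintype.card κ + 1) * (c / (Fintype.card κ + 1)) = c := by field_simp
  linarith

variable [CompactSpace Ω]

/-- The functions `l ↦ u l x - u l x'`, for the pairs `(x, x')` of a compact set, are uniformly
transversal to `0` near `l₀`: such a function is either bounded away from `0`, or its value can
replace one of the coordinates in such a way that the new coordinates expand. By compactness,
this has to be checked at `l₀` only, and the strict differentiability of `u` extends it to a
neighbourhood. -/
theorem exists_uniform_transversality {S : Set (Ω × Ω)} (hS : IsCompact S)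
    (hD : HasStrictFDerivAt u D l₀)
    (hcol : ∀ p ∈ S, u l₀ p.1 = u l₀ p.2 →
      ∃ k, D (EuclideanSpace.single k 1) p.1 ≠ D (EuclideanSpace.single k 1) p.2) :
    ∃ c > 0, ∃ A ≥ 1, ∃ N ∈ 𝓝 l₀, ∀ p ∈ S,
      (∀ l ∈ N, c ≤ ‖u l p.1 - u l p.2‖) ∨
      ∃ k, ∀ l ∈ N, ∀ l' ∈ N, ‖l - l'‖ ≤ A * (‖(u l p.1 - u l p.2) - (u l' p.1 - u l' p.2)‖ +
        ∑ j ∈ Finset.univ.erase k, ‖l j - l' j‖) := by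
  obtain ⟨c, hc0, hc⟩ := exists_pos_le_norm_or_derivative hS hcol
  obtain ⟨N₁, hN₁, happ⟩ := hD.approximates_deriv_on_nhds
    (c := (c / 4).toNNReal) (Or.inr (Real.toNNReal_pos.2 (by positivity)))
  have hN₂ : ∀ᶠ l in 𝓝 l₀, ‖u l - u l₀‖ < c / 4 := by
    have := hD.continuousAt
    rw [Metric.continuousAt_iff'] at this
    simpa only [dist_eq_norm] using this (c / 4) (by positivity)
  refine ⟨c / 2, by positivity, 2 + (2 + 4 * ‖D‖) / c, ?_, N₁ ∩ {l | ‖u l - u l₀‖ < c / 4},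
    inter_mem hN₁ hN₂, fun p hp => ?_⟩
  · have : 0 ≤ (2 + 4 * ‖D‖) / c := by positivity
    linarith
  have hsub : ∀ w : C(Ω, ℂ), ‖w p.1 - w p.2‖ ≤ 2 * ‖w‖ := fun w => by
    have h1 := w.norm_coe_le_norm p.1
    have h2 := w.norm_coe_le_norm p.2
    linarith [norm_sub_le (w p.1) (w p.2)]
  rcases hc p hp with h | ⟨k, hk⟩
  · left
    rintro l ⟨-, hl⟩
    have h1 := hsub (u l - u l₀)
    have h2 := norm_sub_le (u l p.1 - u l p.2) ((u l - u l₀) p.1 - (u l - u l₀) p.2)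
    have h3 : (u l p.1 - u l p.2) - ((u l - u l₀) p.1 - (u l - u l₀) p.2) =
        u l₀ p.1 - u l₀ p.2 := by
      simp only [ContinuousMap.sub_apply]
      ring
    rw [h3] at h2
    have hl' : ‖u l - u l₀‖ < c / 4 := hl
    linarith
  · right
    refine ⟨k, ?_⟩
    rintro l ⟨hl, -⟩ l' ⟨hl', -⟩
    set v := l - l'
    set Δ := ‖(u l p.1 - u l p.2) - (u l' p.1 - u l' p.2)‖
    have hs : ∑ j ∈ Finset.univ.erase k, ‖l j - l' j‖ = ∑ j ∈ Finset.univ.erase k, ‖v j‖ := rfl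
    rw [hs]
    set s := ∑ j ∈ Finset.univ.erase k, ‖v j‖
    have hvs : ‖v‖ ≤ ‖v k‖ + s := by
      refine (EuclideanSpace.norm_le_sum_norm v).trans_eq ?_
      rw [← Finset.add_sum_erase _ _ (Finset.mem_univ k)]
    have hs0 : 0 ≤ s := Finset.sum_nonneg fun _ _ => norm_nonneg _
    have hΔ : 0 ≤ Δ := norm_nonneg _
    have hlin : ‖D v p.1 - D v p.2‖ ≤ Δ + c / 2 * ‖v‖ := by
      have h1 := hsub (u l - u l' - D v)
      have h2 : ‖u l - u l' - D v‖ ≤ c / 4 * ‖v‖ := by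
        have := happ l hl l' hl'
        rwa [Real.coe_toNNReal _ (by positivity)] at this
      have h3 := norm_sub_le ((u l p.1 - u l p.2) - (u l' p.1 - u l' p.2))
        ((u l - u l' - D v) p.1 - (u l - u l' - D v) p.2)
      have h4 : ((u l p.1 - u l p.2) - (u l' p.1 - u l' p.2)) -
          ((u l - u l' - D v) p.1 - (u l - u l' - D v) p.2) = D v p.1 - D v p.2 := by
        simp only [ContinuousMap.sub_apply]
        ring
      rw [h4] at h3
      linarith
    set d : κ → ℂ := fun j =>
      D (EuclideanSpace.single j 1) p.1 - D (EuclideanSpace.single j 1) p.2 with hd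
    have hDv : D v p.1 - D v p.2 = v k * d k + ∑ j ∈ Finset.univ.erase k, v j * d j := by
      rw [Finset.add_sum_erase Finset.univ (fun j => v j * d j) (Finset.mem_univ k)]
      conv_lhs => rw [EuclideanSpace.eq_sum_smul_single v]
      simp [hd, mul_sub, Finset.sum_sub_distrib]
    have hdj : ∀ j, ‖d j‖ ≤ 2 * ‖D‖ := fun j => by
      refine (hsub _).trans ?_
      gcongr
      simpa using D.le_opNorm (EuclideanSpace.single j (1 : ℂ))
    have hrest : ‖∑ j ∈ Finset.univ.erase k, v j * d j‖ ≤ 2 * ‖D‖ * s := by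
      refine (norm_sum_le _ _).trans ?_
      rw [Finset.mul_sum]
      refine Finset.sum_le_sum fun j _ => ?_
      rw [norm_mul, mul_comm]
      gcongr
      exact hdj j
    have hk' : c * ‖v k‖ ≤ Δ + c / 2 * ‖v‖ + 2 * ‖D‖ * s := by
      have h1 : c * ‖v k‖ ≤ ‖v k * d k‖ := by
        rw [norm_mul, mul_comm]
        gcongr
      have h2 := norm_sub_le (D v p.1 - D v p.2) (∑ j ∈ Finset.univ.erase k, v j * d j)
      rw [hDv, add_sub_cancel_right, ← hDv] at h2
      linarith
    have hmain : ‖v‖ * c ≤ 2 * Δ + (2 * c + 4 * ‖D‖) * s := by nlinarith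
    have hfin : (2 + (2 + 4 * ‖D‖) / c) * (Δ + s) * c =
        (2 * c + (2 + 4 * ‖D‖)) * (Δ + s) := by
      field_simp
    refine le_of_mul_le_mul_right (hmain.trans ?_) hc0
    rw [hfin]
    have := norm_nonneg D
    nlinarith [mul_nonneg this hΔ, mul_nonneg hc0.le hΔ]

/-- Uniform transversality gives covers by balls of the sets where the functions are small. -/
theorem exists_cover_of_transversality [Nonempty κ] {c A ρ Q B : ℝ} {S : Set (Ω × Ω)}
    (hc : 0 < c) (hA : 1 ≤ A) (hQ : 0 ≤ Q) {N : Set (EuclideanSpace ℂ κ)}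
    (hρ : ∀ l ∈ N, ‖l‖ ≤ ρ ∧ ‖u l‖ ≤ ρ)
    (htr : ∀ p ∈ S, (∀ l ∈ N, c ≤ ‖u l p.1 - u l p.2‖) ∨
      ∃ k, ∀ l ∈ N, ∀ l' ∈ N, ‖l - l'‖ ≤ A * (‖(u l p.1 - u l p.2) - (u l' p.1 - u l' p.2)‖ +
        ∑ j ∈ Finset.univ.erase k, ‖l j - l' j‖)) :
    ∃ C > 0, ∀ p ∈ S, ∀ r ∈ Ioo 0 B, ∃ t : Finset (EuclideanSpace ℂ κ),
      {l ∈ N | ‖u l p.1 - u l p.2‖ ≤ Q * r} ⊆ ⋃ y ∈ t, Metric.ball y r ∧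
        (t.card : ℝ) ≤ C * r ^ (2 - 2 * (Fintype.card κ : ℤ)) := by
  rcases N.eq_empty_or_nonempty with rfl | ⟨l₁, hl₁⟩
  · exact ⟨1, one_pos, fun p _ r hr => ⟨∅, by simp, by have := hr.1; simp; positivity⟩⟩
  have hρ0 : 0 ≤ ρ := (norm_nonneg l₁).trans (hρ l₁ hl₁).1
  set R := 2 * ρ + Q + ρ * Q / c
  have hR0 : 0 ≤ R := by positivity
  have hRρ : 2 * ρ ≤ R := by
    have : 0 ≤ ρ * Q / c := by positivity
    linarith
  have hRQ : Q ≤ R := by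
    have : 0 ≤ ρ * Q / c := by positivity
    linarith
  refine ⟨(2 * R * (2 * A * Fintype.card κ + 1) + 2 + 2 * max B 0) ^ (2 * Fintype.card κ), ?_,
    fun p hp r hr => ?_⟩
  · have : 0 ≤ max B 0 := le_max_right _ _
    positivity
  rcases htr p hp with h | ⟨k, hk⟩
  · -- the set is empty unless `c ≤ Q * r`, and then any coordinate is at most `R * r`
    obtain ⟨k⟩ := ‹Nonempty κ›
    refine exists_cover_of_expanding (by linarith) hR0 hr.1 (hr.2.le.trans (le_max_left _ _))
      (fun l j => l j) ?_ ?_ k ?_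
    · intro x _ y _
      refine (EuclideanSpace.norm_le_sum_norm (x - y)).trans ?_
      refine le_mul_of_one_le_left (Finset.sum_nonneg fun _ _ => norm_nonneg _) hA
    · rintro l ⟨hl, -⟩ j
      linarith [PiLp.norm_apply_le l j, (hρ l hl).1]
    · rintro l ⟨hl, hle⟩
      have h1 : c ≤ Q * r := (h l hl).trans hle
      calc ‖l k‖ ≤ ρ := (PiLp.norm_apply_le l k).trans (hρ l hl).1
        _ = ρ / c * c := by field_simp
        _ ≤ ρ / c * (Q * r) := by gcongr
        _ = ρ * Q / c * r := by ring
        _ ≤ R * r := by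
          have := hr.1
          gcongr
          linarith
  · refine exists_cover_of_expanding (by linarith) hR0 hr.1 (hr.2.le.trans (le_max_left _ _))
      (fun l j => if j = k then u l p.1 - u l p.2 else l j) ?_ ?_ k ?_
    · rintro x ⟨hx, -⟩ y ⟨hy, -⟩
      refine (hk x hx y hy).trans_eq ?_
      rw [← Finset.add_sum_erase _ _ (Finset.mem_univ k)]
      simp only [if_true]
      congr 2
      refine Finset.sum_congr rfl fun j hj => ?_
      rw [if_neg (Finset.ne_of_mem_erase hj), if_neg (Finset.ne_of_mem_erase hj)]
    · rintro l ⟨hl, -⟩ j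
      dsimp only
      split_ifs
      · have h1 := (u l).norm_coe_le_norm p.1
        have h2 := (u l).norm_coe_le_norm p.2
        linarith [norm_sub_le (u l p.1) (u l p.2), (hρ l hl).2]
      · linarith [PiLp.norm_apply_le l j, (hρ l hl).1]
    · rintro l ⟨hl, hle⟩
      rw [if_pos rfl]
      have := hr.1
      exact hle.trans (by gcongr)

/-- Uniform transversality gives a non-zero gradient. -/
theorem complexGradient_ne_zero_of_transversality {f : EuclideanSpace ℂ κ → ℂ}
    {N : Set (EuclideanSpace ℂ κ)} {l : EuclideanSpace ℂ κ} (hN : N ∈ 𝓝 l) {A : ℝ} {k : κ}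
    (hf : DifferentiableAt ℂ f l)
    (hk : ∀ l' ∈ N, ‖l' - l‖ ≤ A * (‖f l' - f l‖ + ∑ j ∈ Finset.univ.erase k, ‖l' j - l j‖)) :
    complexGradient f l ≠ 0 := by
  intro h0
  have h1 : lineDeriv ℂ f l (EuclideanSpace.single k 1) = 0 := congrFun h0 k
  have h2 : HasDerivAt (fun t : ℂ => f (l + t • EuclideanSpace.single k 1)) 0 0 := by
    have := (hf.lineDifferentiableAt (v := EuclideanSpace.single k 1)).hasLineDerivAt
    rw [h1] at this
    exact this
  have h3 := hasDerivAt_iff_isLittleO_nhds_zero.1 h2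
  have hA : 0 < 1 / (2 * (|A| + 1)) := by positivity
  have h4 := h3.bound hA
  have hcont : ContinuousAt (fun t : ℂ => l + t • EuclideanSpace.single k (1 : ℂ)) 0 := by
    fun_prop
  have h5 : ∀ᶠ t : ℂ in 𝓝 0, l + t • EuclideanSpace.single k (1 : ℂ) ∈ N := by
    refine hcont.eventually_mem ?_
    simpa using hN
  obtain ⟨t, ⟨ht, htN⟩, ht0⟩ := ((h4.and h5).filter_mono nhdsWithin_le_nhds |>.and
    (self_mem_nhdsWithin (a := (0 : ℂ)) (s := {0}ᶜ))).exists
  have h6 := hk _ htN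
  have h7 : ∑ j ∈ Finset.univ.erase k,
      ‖(l + t • EuclideanSpace.single k (1 : ℂ)) j - l j‖ = 0 := by
    refine Finset.sum_eq_zero fun j hj => ?_
    simp [Finset.ne_of_mem_erase hj]
  rw [h7, add_zero, add_sub_cancel_left, norm_smul] at h6
  simp only [zero_add, zero_smul, add_zero, smul_zero, sub_zero, PiLp.norm_single, norm_one,
    mul_one] at ht h6
  have htp : 0 < ‖t‖ := norm_pos_iff.2 ht0
  set y := ‖f (l + t • EuclideanSpace.single k 1) - f l‖
  have hy : 0 ≤ y := norm_nonneg _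
  have h8 : A * y ≤ (|A| + 1) * y := by
    gcongr
    linarith [le_abs_self A]
  have h9 : (|A| + 1) * y ≤ (|A| + 1) * (1 / (2 * (|A| + 1)) * ‖t‖) := by gcongr
  have h10 : (|A| + 1) * (1 / (2 * (|A| + 1)) * ‖t‖) = ‖t‖ / 2 := by field_simp
  linarith

end Transversality

namespace RatSemi

variable {m : ℕ}

/-! ### The family of affine tuples -/

theorem coding_const {l : AffineParam m} {η : ℝ} (hη : 1 < η) (hl : ∀ i, η ≤ ‖l (i, 0)‖)
    (i : Fin m) : (coding l fun _ => i) = -l (i, 1) / (l (i, 0) - 1) := by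
  have h : (coding l fun _ => i) = l (i, 0) * (coding l fun _ => i) + l (i, 1) :=
    isCoding_coding hη hl fun _ => i
  have h1 : l (i, 0) - 1 ≠ 0 := by
    rw [sub_ne_zero]
    intro h1
    have := hl i
    rw [h1, norm_one] at this
    linarith
  rw [eq_div_iff h1]
  linear_combination -h

/-- The second component of the conjugacies: the point with code `ω` is sent to the point with
code `ω`. -/
noncomputable def codingMap (l : AffineParam m) (x : Words m × RSphere) : RSphere :=
  (coding l x.1 : ℂ)

theorem skewJulia_affineTuple {l : AffineParam m} {η : ℝ} (hη : 1 < η)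
    (hl : ∀ i, η ≤ ‖l (i, 0)‖) :
    skewJulia (affineTuple l) = {x | x.2 = codingMap l x} :=
  skewJulia_eq (isCoding_coding hη hl) hη hl

theorem continuous_codingMap_left (l : AffineParam m) : Continuous (codingMap l) :=
  OnePoint.continuous_coe.comp ((coding l).continuous.comp continuous_fst)

theorem isConjugacyFamily_codingMap {U : Set (AffineParam m)} {l₀ : AffineParam m} {η : ℝ}
    (hη : 1 < η) (hU : ∀ l ∈ U, ∀ i, η ≤ ‖l (i, 0)‖) (hl₀ : l₀ ∈ U) :
    IsConjugacyFamily affineTuple U l₀ codingMap where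
  homeo l hl := by
    have h := skewJulia_affineTuple hη (hU l hl)
    have h₀ := skewJulia_affineTuple hη (hU l₀ hl₀)
    refine ⟨⟨⟨fun x => ⟨(x.1.1, codingMap l x.1), ?_⟩, fun x => ⟨(x.1.1, codingMap l₀ x.1), ?_⟩,
      fun x => ?_, fun x => ?_⟩, ?_, ?_⟩, fun x => rfl⟩
    · rw [h]; rfl
    · rw [h₀]; rfl
    · have hx : x.1.2 = codingMap l₀ x.1 := (Set.ext_iff.1 h₀ x.1).1 x.2
      exact Subtype.ext (Prod.ext rfl hx.symm)
    · have hx : x.1.2 = codingMap l x.1 := (Set.ext_iff.1 h x.1).1 x.2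
      exact Subtype.ext (Prod.ext rfl hx.symm)
    · exact ((continuous_fst.comp continuous_subtype_val).prodMk
        ((continuous_codingMap_left l).comp continuous_subtype_val)).subtype_mk _
    · exact ((continuous_fst.comp continuous_subtype_val).prodMk
        ((continuous_codingMap_left l₀).comp continuous_subtype_val)).subtype_mk _
  base x hx := by
    rw [skewJulia_affineTuple hη (hU l₀ hl₀)] at hx
    exact hx.symm
  conj l hl x _ := by
    refine Prod.ext rfl ?_
    change ((coding l (shift x.1) : ℂ) : RSphere) = affineTuple l (x.1 0) (coding l x.1 : ℂ)
    rw [isCoding_coding hη (hU l hl)]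
    rfl
  cont := by
    have hc : ContinuousOn (coding : AffineParam m → _) U := fun l hl =>
      (contDiffAt_coding hη (hU l hl)).continuousAt.continuousWithinAt
    have h1 : ContinuousOn (fun y : (Words m × RSphere) × AffineParam m => coding y.2)
        (skewJulia (affineTuple l₀) ×ˢ U) :=
      hc.comp continuousOn_snd fun y hy => hy.2
    exact OnePoint.continuous_coe.comp_continuousOn
      (h1.eval (continuousOn_fst.fst))

theorem affineTuple_mem_expSet (hm : 0 < m) {l : AffineParam m} {η : ℝ} (hη : 1 < η)
    (hl : ∀ i, η ≤ ‖l (i, 0)‖) : affineTuple l ∈ ExpSet m :=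
  mem_expSet hm (isCoding_coding hη hl) hη hl

theorem isHolomorphicFamily_affineTuple (hm : 0 < m) {U : Set (AffineParam m)} {η : ℝ}
    (hη : 1 < η) (hU : ∀ l ∈ U, ∀ i, η ≤ ‖l (i, 0)‖) : IsHolomorphicFamily affineTuple U := by
  refine ⟨fun l hl => affineTuple_mem_expSet hm hη (hU l hl), fun j l hl z => ?_⟩
  have h0 : l (j, 0) ≠ 0 := norm_pos_iff.1 (by linarith [hU l hl j])
  have hd : ∀ k, DifferentiableAt ℂ (fun x : AffineParam m => x k) l := fun k =>
    (contDiff_apply_affineParam k).differentiable one_ne_zero l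
  exact ⟨continuousAt_affine (hd (j, 0)).continuousAt (hd (j, 1)).continuousAt h0 z,
    differentiableAt_affine (hd (j, 0)) (hd (j, 1)) h0 z⟩

theorem eventually_sphDist_affineTuple_lt {l : AffineParam m} (hl : ∀ i, l (i, 0) ≠ 0) {ε : ℝ}
    (hε : 0 < ε) : ∀ᶠ x in 𝓝 l, ∀ j z, sphDist (affineTuple x j z) (affineTuple l j z) < ε := by
  refine eventually_all.2 fun j => ?_
  have hc : Continuous fun x : AffineParam m =>
      2 * Real.pi * (‖x (j, 0) - l (j, 0)‖ + ‖x (j, 1) - l (j, 1)‖) *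
        (1 + (1 + ‖l (j, 1)‖) / ‖l (j, 0)‖) := by fun_prop
  have ht := hc.tendsto l
  simp only [sub_self, norm_zero, add_zero, mul_zero, zero_mul] at ht
  filter_upwards [ht.eventually_lt_const hε] with x hx z
  exact (sphDist_affine_affine_le (hl j) z).trans_lt hx

theorem setting_affineTuple (hm : 0 < m) {U : Set (AffineParam m)} {l₀ : AffineParam m} {η : ℝ}
    (hη : 1 < η) (hU : ∀ l ∈ U, ∀ i, η ≤ ‖l (i, 0)‖) (hopen : IsOpen U)
    (hbdd : Bornology.IsBounded U) (hl₀ : l₀ ∈ U) : Setting affineTuple U l₀ codingMap where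
  isOpen := hopen
  isBounded := hbdd
  mem := hl₀
  exp l hl := affineTuple_mem_expSet hm hη (hU l hl)
  cont l hl ε hε := (eventually_sphDist_affineTuple_lt (fun i => norm_pos_iff.1
    (by linarith [hU l hl i])) hε).filter_mono nhdsWithin_le_nhds
  conjugacy := isConjugacyFamily_codingMap hη hU hl₀

theorem differentiableAt_coding_apply {l : AffineParam m} {η : ℝ} (hη : 1 < η)
    (hl : ∀ i, η ≤ ‖l (i, 0)‖) (ω : Words m) :
    DifferentiableAt ℂ (fun x : AffineParam m => coding x ω) l :=
  (ContinuousMap.evalCLM ℂ ω : C(Words m, ℂ) →L[ℂ] ℂ).differentiableAt.comp l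
    ((contDiffAt_coding hη hl).differentiableAt one_ne_zero)

theorem finrank_affineParam :
    Module.finrank ℝ (AffineParam m) = 2 * Fintype.card (Fin m × Fin 2) := by
  rw [finrank_real_of_complex, finrank_euclideanSpace]

end RatSemi

theorem theorem4p7 (m : ℕ) (hm : 2 ≤ m) (a b : Fin m → ℂ) (ha : ∀ i, 1 < ‖a i‖)
    (g : Fin m → RSphere → RSphere) (hg : g = fun i => affine (a i) (b i))
    (h_i : ∀ i j, i ≠ j → (g i ⁻¹' juliaSet g ∩ g j ⁻¹' juliaSet g).Nonempty →
      ∃ α : Fin m, g i '' (g i ⁻¹' juliaSet g ∩ g j ⁻¹' juliaSet g) ⊆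
        {((-b α / (a α - 1) : ℂ) : RSphere)})
    (h_ii : ∀ i j k, i ≠ j → i ≠ k → j ≠ k →
      g k '' (g i ⁻¹' juliaSet g ∩ g j ⁻¹' juliaSet g) ⊆ fatouSet g)
    (h_iii : ∀ j k, j ≠ k → g k ((-b j / (a j - 1) : ℂ) : RSphere) ∈ fatouSet g) :
    ∃ U : Set (AffineParam m), IsOpen U ∧ affineCoord a b ∈ U ∧ U ⊆ autParams m ∧
      IsHolomorphicFamily affineTuple U ∧
      ∃ hbar : AffineParam m → Words m × RSphere → RSphere,
        ATC affineTuple U (affineCoord a b) hbar ∧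
        STC affineTuple U (affineCoord a b) hbar ∧
        TC affineTuple U (affineCoord a b) hbar := by
  have hm0 : 0 < m := by omega
  have : Nonempty (Fin m × Fin 2) := ⟨(⟨0, hm0⟩, 0)⟩
  -- a uniform rate of expansion, which persists near the given coefficients
  obtain ⟨η, hη₀, hη⟩ : ∃ η : ℝ, (∀ i, η < ‖a i‖) ∧ 1 < η :=
    (((eventually_all.2 fun i => eventually_lt_nhds (ha i)).filter_mono
      (nhdsWithin_le_nhds (s := Ioi 1))).and self_mem_nhdsWithin).exists
  set l₀ := affineCoord a b with hl₀
  have hl₀0 : ∀ i, l₀ (i, 0) = a i := fun i => by simp [hl₀, affineCoord]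
  have hl₀1 : ∀ i, l₀ (i, 1) = b i := fun i => by simp [hl₀, affineCoord]
  have hexp₀ : ∀ i, η ≤ ‖l₀ (i, 0)‖ := fun i => by rw [hl₀0]; exact (hη₀ i).le
  obtain rfl : g = affineTuple l₀ := by rw [hg, affineTuple_affineCoord]
  have hu := isCoding_coding hη hexp₀
  have hJ : juliaSet (affineTuple l₀) = range fun ω => (coding l₀ ω : RSphere) :=
    juliaSet_eq hu hη hexp₀
  have hp : ∀ i, ((-b i / (a i - 1) : ℂ) : RSphere) = (coding l₀ fun _ => i : ℂ) := fun i => by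
    rw [coding_const hη hexp₀, hl₀0, hl₀1]
  -- the strict derivative of the coding at the given coefficients
  have hC := contDiffAt_coding hη hexp₀
  have hD := hC.hasStrictFDerivAt one_ne_zero
  set D := fderiv ℂ (coding : AffineParam m → C(Words m, ℂ)) l₀
  have hcollide : ∀ ω ω' : Words m, ω 0 ≠ ω' 0 → coding l₀ ω = coding l₀ ω' →
      ∃ k, D (EuclideanSpace.single k 1) ω ≠ D (EuclideanSpace.single k 1) ω' := by
    intro ω ω' hne h
    refine exists_derivative_ne hu (fun i => norm_pos_iff.1 (by linarith [hexp₀ i]))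
      (fun i hi => ?_) (fun v ω => fderiv_coding_shift hη (fun i => by rw [hl₀0]; exact hη₀ i)
        hD.hasFDerivAt ω v) ?_ ?_ hne h
    · have := hexp₀ i
      rw [hi, norm_one] at this
      linarith
    · intro ω ω' hne h
      have hmem : ((coding l₀ ω : ℂ) : RSphere) ∈ affineTuple l₀ (ω 0) ⁻¹' juliaSet
          (affineTuple l₀) ∩ affineTuple l₀ (ω' 0) ⁻¹' juliaSet (affineTuple l₀) := by
        rw [hJ]
        refine ⟨⟨shift ω, ?_⟩, ⟨shift ω', ?_⟩⟩
        · dsimp only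
          rw [hu]
          rfl
        · dsimp only
          rw [hu, h]
          rfl
      obtain ⟨p, hsub⟩ := h_i _ _ hne ⟨_, hmem⟩
      have h1 := hsub (mem_image_of_mem _ hmem)
      rw [hp, mem_singleton_iff] at h1
      refine ⟨p, ?_⟩
      rw [hu]
      exact OnePoint.coe_injective h1
    · intro j k hjk ω h
      have h1 := h_iii j k hjk
      rw [hp] at h1
      have h2 : affineTuple l₀ k ((coding l₀ fun _ => j : ℂ) : RSphere) ∈
          juliaSet (affineTuple l₀) := by
        rw [hJ]
        exact ⟨ω, congrArg _ h.symm⟩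
      exact h2 h1
  have hS : IsCompact {p : Words m × Words m | p.1 0 ≠ p.2 0} := by
    have hf : Continuous fun p : Words m × Words m => (p.1 0, p.2 0) := by fun_prop
    exact ((isClosed_discrete {q : Fin m × Fin m | q.1 ≠ q.2}).preimage hf).isCompact
  obtain ⟨c, hc, A, hA, N, hN, htr⟩ := exists_uniform_transversality hS hD
    (fun p hp h => hcollide p.1 p.2 hp h)
  -- the neighbourhood: a ball where transversality, expansion and bounds are uniform
  have hN' : ∀ᶠ l in 𝓝 l₀, l ∈ N ∧ (∀ i, η ≤ ‖l (i, 0)‖) ∧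
      ‖l‖ ≤ ‖l₀‖ + ‖coding l₀‖ + 1 ∧ ‖coding l‖ ≤ ‖l₀‖ + ‖coding l₀‖ + 1 := by
    have h1 : ∀ᶠ l : AffineParam m in 𝓝 l₀, ∀ i, η < ‖l (i, 0)‖ := eventually_all.2 fun i =>
      ((contDiff_apply_affineParam (i, 0)).continuous.norm.continuousAt).eventually_const_lt
        (by change η < ‖l₀ (i, 0)‖; rw [hl₀0]; exact hη₀ i)
    have h2 := (continuous_norm.continuousAt (x := l₀)).eventually_lt_const (lt_add_one _)
    have h3 := hC.continuousAt.norm.eventually_lt_const (lt_add_one _)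
    filter_upwards [hN, h1, h2, h3] with l hl h1 h2 h3
    exact ⟨hl, fun i => (h1 i).le, by linarith [norm_nonneg (coding l₀)],
      by linarith [norm_nonneg l₀]⟩
  obtain ⟨δ, hδ, hball⟩ := Metric.mem_nhds_iff.1 hN'
  set U := Metric.ball l₀ δ
  set ρ := ‖l₀‖ + ‖coding l₀‖ + 1
  have hUN : ∀ l ∈ U, l ∈ N := fun l hl => (hball hl).1
  have hUexp : ∀ l ∈ U, ∀ i, η ≤ ‖l (i, 0)‖ := fun l hl => (hball hl).2.1
  have hUρ : ∀ l ∈ U, ‖l‖ ≤ ρ ∧ ‖coding l‖ ≤ ρ := fun l hl => (hball hl).2.2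
  have hl₀U : l₀ ∈ U := Metric.mem_ball_self hδ
  have hUopen : IsOpen U := Metric.isOpen_ball
  have hset := setting_affineTuple hm0 hη hUexp hUopen Metric.isBounded_ball hl₀U
  have hhol := isHolomorphicFamily_affineTuple hm0 hη hUexp
  have htrU : ∀ p ∈ {p : Words m × Words m | p.1 0 ≠ p.2 0},
      (∀ l ∈ U, c ≤ ‖coding l p.1 - coding l p.2‖) ∨
      ∃ k, ∀ l ∈ U, ∀ l' ∈ U, ‖l - l'‖ ≤ A * (‖(coding l p.1 - coding l p.2) -
        (coding l' p.1 - coding l' p.2)‖ + ∑ j ∈ Finset.univ.erase k, ‖l j - l' j‖) := by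
    intro p hp
    rcases htr p hp with h | ⟨k, h⟩
    · exact Or.inl fun l hl => h l (hUN l hl)
    · exact Or.inr ⟨k, fun l hl l' hl' => h l (hUN l hl) l' (hUN l' hl')⟩
  obtain ⟨C, hC0, hcover⟩ := exists_cover_of_transversality (B := sphDiam)
    (Q := (1 + ρ) ^ 2) hc hA (by positivity) hUρ htrU
  -- closeness of the conjugacies in the spherical distance is closeness of the codings
  have hclose : ∀ (x x' : Words m × RSphere) (r : ℝ), closeParams U codingMap x x' r ⊆
      {l ∈ U | ‖coding l x.1 - coding l x'.1‖ ≤ (1 + ρ) ^ 2 * r} := by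
    rintro x x' r l ⟨hl, hle⟩
    refine ⟨hl, ?_⟩
    refine (norm_sub_le_mul_sphDist (((coding l).norm_coe_le_norm _).trans (hUρ l hl).2)
      (((coding l).norm_coe_le_norm _).trans (hUρ l hl).2)).trans ?_
    exact mul_le_mul_of_nonneg_left hle (by positivity)
  refine ⟨U, hUopen, hl₀U, fun l hl i => norm_pos_iff.1 (by linarith [hUexp l hl i]), hhol,
    codingMap, ⟨hUopen, hl₀U, hhol, hset.conjugacy, ?_, ?_, ?_⟩, ⟨hset, C, hC0, ?_⟩,
    ⟨hset, (volume (Metric.ball (0 : AffineParam m) 1)).toReal * C, ?_, ?_⟩⟩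
  · intro x _ l hl
    have hd := differentiableAt_coding_apply hη (hUexp l hl) x.1
    exact ⟨(OnePoint.continuous_coe.tendsto _).comp hd.continuousAt, hd⟩
  · intro l hl h
    have hJl : juliaSet (affineTuple l) = range fun ω => (coding l ω : RSphere) :=
      juliaSet_eq (isCoding_coding hη (hUexp l hl)) hη (hUexp l hl)
    rw [hJl] at h
    obtain ⟨ω, hω⟩ := h
    exact OnePoint.coe_ne_infty _ hω
  · intro x _ x' _ hne l hl h0
    change coding l x.1 - coding l x'.1 = 0 at h0
    rcases htrU (x.1, x'.1) hne with h | ⟨k, hk⟩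
    · have := h l hl
      rw [h0, norm_zero] at this
      linarith
    · exact complexGradient_ne_zero_of_transversality (hUopen.mem_nhds hl)
        ((differentiableAt_coding_apply hη (hUexp l hl) x.1).sub
          (differentiableAt_coding_apply hη (hUexp l hl) x'.1)) fun l' hl' => hk l' hl' l hl
  · intro r hr x _ x' _ hne
    obtain ⟨t, ht, hcard⟩ := hcover (x.1, x'.1) hne r hr
    rw [finrank_affineParam]
    refine ballCoveringNumber_le_of_cover ((hclose x x' r).trans ht) ?_
    push_cast
    exact_mod_cast hcard
  · exact mul_pos (ENNReal.toReal_pos (Metric.measure_ball_pos _ _ one_pos).ne'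
      measure_ball_lt_top.ne) hC0
  · intro r hr x _ x' _ hne
    obtain ⟨t, ht, hcard⟩ := hcover (x.1, x'.1) hne r hr
    have hr0 := hr.1
    refine (volume_le_of_cover hr.1 (by positivity) ((hclose x x' r).trans ht) hcard).trans_eq ?_
    rw [finrank_affineParam]
    congr 1
    have : r ^ (2 - 2 * (Fintype.card (Fin m × Fin 2) : ℤ)) *
        r ^ (2 * Fintype.card (Fin m × Fin 2)) = r ^ 2 := by
      rw [← zpow_natCast, ← zpow_add₀ hr0.ne']
      push_cast
      rw [sub_add_cancel]
      norm_cast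
    rw [← this]
    ring
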